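/- Let $X$ be a complex Hilbert space. Equip $W^{1,2}([-1,0],X)$ with the norm $(\|f\|_{L^2}^2+\|f'\|_{L^2}^2)^{1/2}$, and let $\Phi\colon W^{1,2}([-1,0],X)\to X$ be a bounded linear operator. Let $\mathcal E:=X\times L^2([-1,0],X)$ with the $2$-norm of the product. For a linear operator $(B,D(B))$ on $X$ let $\mathcal A=\mathcal A_{B,\Phi}$ be the operator on $\mathcal E$ given by $$\mathcal A\binom{x}{f}=\binom{Bx+\Phi f}{f'},\qquad D(\mathcal A)=\Big\{\tbinom{x}{f}\in D(B)\times W^{1,2}([-1,0],X): f(0)=x\Big\}.$$ For $\lambda\in\mathbb C$ let $\Phi_\lambda\in\mathcal L(X)$ be defined by $\Phi_\lambda x:=\Phi(e^{\lambda\,\cdot}x)$, and write $R(\lambda,G)=(\lambda-G)^{-1}$ for the resolvent of an operator $G$. Let $A_0f=f'$ with domain $D(A_0)=\{f\in W^{1,2}([-1,0],X): f(0)=0\}$ be the generator of the nilpotent left shift semigroup on $L^2([-1,0],X)$. The operator $\Phi$ is called admissible if (a) $\mathcal A_{B,\Phi}$ generates a strongly continuous semigroup on $\mathcal E$ for every generator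 $(B,D(B))$ of a strongly continuous semigroup on $X$, and (b) for every $\omega\in\mathbb R$ the function $\lambda\mapsto\Phi R(\lambda,A_0)\in\mathcal L(L^2([-1,0],X),X)$ is bounded and analytic on $\{\lambda\in\mathbb C:\operatorname{Re}\lambda>\omega\}$. A strongly continuous semigroup $(T(t))_{t\ge0}$ on a Banach space $E$ is called hyperbolic if $E=E_s\oplus E_u$ with closed $T(t)$-invariant subspaces such that $T(t)|_{E_u}$ is a bijection of $E_u$ for every $t\ge0$ and, for some constants $M$ and $\varepsilon>0$, $\|T(t)|_{E_s}\|\le Me^{-\varepsilon t}$ and $\|(T(t)|_{E_u})^{-1}\|\le Me^{-\varepsilon t}$ for all $t\ge0$. **Corollary.** Assume that $\Phi$ is admissible and that $(B,D(B))$ generates a hyperbolic strongly continuous semigroup on $X$. If $$\sup_{\omega\in\mathbb R}\|\Phi_{i\omega}R(i\omega,B)\|<1,$$ or in particular if $$\sup_{\omega\in\mathbb R}\|\Phi_{i\omega}\|<\frac1{\sup_{\omega\in\mathbb R}\|R(i\omega,B)\|}$$ (where $1/0:=\infty$), then $(\mathcal A,D(\mathcal A))$ generates a hyperbolic strongly continuous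 semigroup on $\mathcal E$. -/

import Mathlib

open MeasureTheory Set Filter Topology
open scoped ENNReal

noncomputable section

namespace DelayEq

/-! ### Strongly continuous semigroups, generators, hyperbolicity, resolvents -/

section Semigroups

/-- A strongly continuous one-parameter semigroup of bounded operators on `E`.
Only the values of `T` at times `t ≥ 0` matter. -/
structure C0Semigroup (E : Type*) [NormedAddCommGroup E] [NormedSpace ℂ E] where
  T : ℝ → E →L[ℂ] E
  zero : T 0 = ContinuousLinearMap.id ℂ E
  add : ∀ s t : ℝ, 0 ≤ s → 0 ≤ t → T (s + t) = (T s).comp (T t)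
  cont : ∀ x : E, ContinuousOn (fun t => T t x) (Ici 0)

variable {E : Type*} [NormedAddCommGroup E] [NormedSpace ℂ E]

/-- The unbounded operator `A` (with its domain) is the generator of the semigroup `S`:
`x ∈ D(A)` and `A x = y` if and only if `(T(t) x - x) / t → y` as `t ↓ 0`. -/
def IsGeneratorOf (A : E →ₗ.[ℂ] E) (S : C0Semigroup E) : Prop :=
  ∀ x y : E, (∃ hx : x ∈ A.domain, A ⟨x, hx⟩ = y) ↔
    Tendsto (fun t : ℝ => (t : ℂ)⁻¹ • (S.T t x - x)) (𝓝[>] 0) (𝓝 y)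

/-- `A` generates a strongly continuous semigroup. -/
def IsGenerator (A : E →ₗ.[ℂ] E) : Prop :=
  ∃ S : C0Semigroup E, IsGeneratorOf A S

/-- A semigroup is hyperbolic if `E` is the direct sum of two closed invariant subspaces such that
the semigroup is uniformly exponentially stable on the first one, and is invertible on the second
one with uniformly exponentially stable inverses. -/
def C0Semigroup.IsHyperbolic (S : C0Semigroup E) : Prop :=
  ∃ Es Eu : Submodule ℂ E,
    IsClosed (Es : Set E) ∧ IsClosed (Eu : Set E) ∧ IsCompl Es Eu ∧
    (∀ t : ℝ, 0 ≤ t → MapsTo (S.T t) Es Es) ∧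
    (∀ t : ℝ, 0 ≤ t → BijOn (S.T t) Eu Eu) ∧
    ∃ M ε : ℝ, 0 < ε ∧
      (∀ t : ℝ, 0 ≤ t → ∀ x ∈ Es, ‖S.T t x‖ ≤ M * Real.exp (-ε * t) * ‖x‖) ∧
      (∀ t : ℝ, 0 ≤ t → ∀ x ∈ Eu, ‖x‖ ≤ M * Real.exp (-ε * t) * ‖S.T t x‖)

/-- `A` generates a hyperbolic strongly continuous semigroup. -/
def GeneratesHyperbolic (A : E →ₗ.[ℂ] E) : Prop :=
  ∃ S : C0Semigroup E, IsGeneratorOf A S ∧ S.IsHyperbolic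

/-- `R` is a bounded two-sided inverse of `z - A : D(A) → E`. -/
def IsResolventAt (A : E →ₗ.[ℂ] E) (z : ℂ) (R : E →L[ℂ] E) : Prop :=
  (∀ y : E, ∃ hy : R y ∈ A.domain, z • R y - A ⟨R y, hy⟩ = y) ∧
    ∀ x : A.domain, R (z • (x : E) - A x) = x

open Classical in
/-- The resolvent `R(z, A) = (z - A)⁻¹` (with value `0` if `z` is not in the resolvent set). -/
def resolvent (A : E →ₗ.[ℂ] E) (z : ℂ) : E →L[ℂ] E :=
  if h : ∃ R : E →L[ℂ] E, IsResolventAt A z R then h.choose else 0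

end Semigroups

/-! ### The history space and the Sobolev space on `[-1, 0]` -/

section Sobolev

/-- Lebesgue measure on `[-1, 0]`. -/
abbrev μI : Measure ℝ := volume.restrict (Icc (-1 : ℝ) 0)

variable (X : Type*) [NormedAddCommGroup X] [NormedSpace ℂ X]

/-- The space `L²([-1, 0], X)`. -/
abbrev L2 : Type _ := Lp X 2 μI

variable {X}

/-- `g` is the weak derivative of `f` on `(-1, 0)`. -/
def IsWeakDeriv (f g : L2 X) : Prop :=
  ∀ φ : ℝ → ℝ, ContDiff ℝ (⊤ : ℕ∞) φ → HasCompactSupport φ → tsupport φ ⊆ Ioo (-1 : ℝ) 0 →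
    ∫ s, deriv φ s • f s ∂μI = - ∫ s, φ s • g s ∂μI

theorem integrable_smul_L2 {φ : ℝ → ℝ} (hc : Continuous φ) (hs : HasCompactSupport φ) (f : L2 X) :
    Integrable (fun s => φ s • f s) μI := by
  have hf : Integrable f μI := (Lp.memLp f).integrable (by norm_num)
  obtain ⟨C, hC⟩ := hs.exists_bound_of_continuous hc
  exact Integrable.bdd_smul (𝕜 := ℝ) hf C hc.aestronglyMeasurable (Eventually.of_forall hC)

theorem integrable_deriv_smul_L2 {φ : ℝ → ℝ} (hc : ContDiff ℝ (⊤ : ℕ∞) φ) (hs : HasCompactSupport φ)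
    (f : L2 X) : Integrable (fun s => deriv φ s • f s) μI :=
  integrable_smul_L2 (hc.continuous_deriv (by simp)) hs.deriv f

theorem isWeakDeriv_zero : IsWeakDeriv (0 : L2 X) 0 := by
  intro φ _ _ _
  have h : ∀ ψ : ℝ → ℝ, ∫ s, ψ s • (0 : L2 X) s ∂μI = 0 := by
    intro ψ
    apply integral_eq_zero_of_ae
    filter_upwards [Lp.coeFn_zero X 2 μI] with s hs
    rw [hs, Pi.zero_apply, smul_zero]
  rw [h, h, neg_zero]

theorem IsWeakDeriv.add {f g f' g' : L2 X} (h : IsWeakDeriv f g) (h' : IsWeakDeriv f' g') :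
    IsWeakDeriv (f + f') (g + g') := by
  intro φ h1 h2 h3
  have e : ∀ ψ : ℝ → ℝ, ∀ a b : L2 X, Integrable (fun s => ψ s • a s) μI →
      Integrable (fun s => ψ s • b s) μI →
      ∫ s, ψ s • (a + b) s ∂μI = ∫ s, ψ s • a s ∂μI + ∫ s, ψ s • b s ∂μI := by
    intro ψ a b ha hb
    rw [← integral_add ha hb]
    apply integral_congr_ae
    filter_upwards [Lp.coeFn_add a b] with s hs
    rw [hs, Pi.add_apply, smul_add]
  rw [e _ _ _ (integrable_deriv_smul_L2 h1 h2 f) (integrable_deriv_smul_L2 h1 h2 f'),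
    e _ _ _ (integrable_smul_L2 h1.continuous h2 g) (integrable_smul_L2 h1.continuous h2 g'),
    h φ h1 h2 h3, h' φ h1 h2 h3, neg_add]

theorem IsWeakDeriv.smul (c : ℂ) {f g : L2 X} (h : IsWeakDeriv f g) :
    IsWeakDeriv (c • f) (c • g) := by
  intro φ h1 h2 h3
  have e : ∀ ψ : ℝ → ℝ, ∀ a : L2 X,
      ∫ s, ψ s • (c • a) s ∂μI = c • ∫ s, ψ s • a s ∂μI := by
    intro ψ a
    rw [← integral_smul]
    apply integral_congr_ae
    filter_upwards [Lp.coeFn_smul c a] with s hs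
    simp only [hs, Pi.smul_apply]
    rw [smul_comm]
  rw [e, e, h φ h1 h2 h3, smul_neg]

theorem IsWeakDeriv.eq_zero [CompleteSpace X] {g : L2 X} (h : IsWeakDeriv 0 g) : g = 0 := by
  have hg : Integrable g μI := (Lp.memLp g).integrable (by norm_num)
  have key := isOpen_Ioo.ae_eq_zero_of_integral_contDiff_smul_eq_zero (U := Ioo (-1 : ℝ) 0)
    (f := g) (μ := μI) (hg.locallyIntegrable.locallyIntegrableOn _) (by
      intro φ h1 h2 h3
      have h4 := h φ h1 h2 h3
      have h5 : ∫ s, deriv φ s • (0 : L2 X) s ∂μI = 0 := by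
        apply integral_eq_zero_of_ae
        filter_upwards [Lp.coeFn_zero X 2 μI] with s hs
        rw [hs, Pi.zero_apply, smul_zero]
      rw [h5] at h4
      exact neg_eq_zero.mp h4.symm)
  have hmem : ∀ᵐ s ∂μI, s ∈ Ioo (-1 : ℝ) 0 := by
    rw [μI, ← restrict_Ioo_eq_restrict_Icc]
    exact ae_restrict_mem measurableSet_Ioo
  apply (Lp.eq_zero_iff_ae_eq_zero).2
  filter_upwards [key, hmem] with s h1 h2 using h1 h2

variable (X)

/-- The Sobolev space `W^{1,2}([-1, 0], X)`: an element is a function `f ∈ L²` together with its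
weak derivative `f' ∈ L²`, and the norm is `(‖f‖² + ‖f'‖²)^{1/2}`. -/
def W12 : Submodule ℂ (WithLp 2 (L2 X × L2 X)) where
  carrier := {w | IsWeakDeriv w.fst w.snd}
  zero_mem' := isWeakDeriv_zero
  add_mem' := fun h h' => IsWeakDeriv.add h h'
  smul_mem' := fun c _ h => IsWeakDeriv.smul c h

variable {X}

/-- The inclusion `W^{1,2} → L²`. -/
def W12.toL2 : W12 X →ₗ[ℂ] L2 X := (WithLp.fstₗ 2 ℂ (L2 X) (L2 X)).comp (W12 X).subtype

/-- The derivative `d/dσ : W^{1,2} → L²`. -/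
def W12.deriv : W12 X →ₗ[ℂ] L2 X := (WithLp.sndₗ 2 ℂ (L2 X) (L2 X)).comp (W12 X).subtype

theorem W12.toL2_injective [CompleteSpace X] : Function.Injective (W12.toL2 : W12 X →ₗ[ℂ] L2 X) := by
  rw [← LinearMap.ker_eq_bot, LinearMap.ker_eq_bot']
  intro w hw
  have h0 : (w : WithLp 2 (L2 X × L2 X)).fst = 0 := hw
  have h1 : IsWeakDeriv (w : WithLp 2 (L2 X × L2 X)).fst (w : WithLp 2 (L2 X × L2 X)).snd := w.2
  rw [h0] at h1
  have h2 := h1.eq_zero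
  apply Subtype.ext
  apply WithLp.ofLp_injective
  exact Prod.ext h0 h2

/-- An `L²` function that lies in `W^{1,2}`, as an element of `W^{1,2}`. -/
def W12.lift [CompleteSpace X] : LinearMap.range (W12.toL2 : W12 X →ₗ[ℂ] L2 X) →ₗ[ℂ] W12 X :=
  (LinearEquiv.ofInjective W12.toL2 W12.toL2_injective).symm.toLinearMap

/-- `f(0) = x`, where `f(0)` is the value at `0` of the continuous representative of `f`. -/
def W12.HasValueAtZero (w : W12 X) (x : X) : Prop :=
  ∃ u : ℝ → X, ContinuousOn u (Icc (-1 : ℝ) 0) ∧ W12.toL2 w =ᵐ[μI] u ∧ u 0 = x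

theorem W12.HasValueAtZero.zero : W12.HasValueAtZero (0 : W12 X) 0 := by
  refine ⟨fun _ => 0, continuousOn_const, ?_, rfl⟩
  rw [map_zero]
  exact Lp.coeFn_zero X 2 μI

theorem W12.HasValueAtZero.add {w w' : W12 X} {x x' : X} (h : W12.HasValueAtZero w x)
    (h' : W12.HasValueAtZero w' x') : W12.HasValueAtZero (w + w') (x + x') := by
  obtain ⟨u, hc, hu, rfl⟩ := h
  obtain ⟨u', hc', hu', rfl⟩ := h'
  refine ⟨fun s => u s + u' s, hc.add hc', ?_, rfl⟩
  rw [map_add]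
  filter_upwards [Lp.coeFn_add (W12.toL2 w) (W12.toL2 w'), hu, hu'] with s h1 h2 h3
  rw [h1, Pi.add_apply, h2, h3]

theorem W12.HasValueAtZero.smul (c : ℂ) {w : W12 X} {x : X} (h : W12.HasValueAtZero w x) :
    W12.HasValueAtZero (c • w) (c • x) := by
  obtain ⟨u, hc, hu, rfl⟩ := h
  refine ⟨fun s => c • u s, hc.const_smul c, ?_, rfl⟩
  rw [map_smul]
  filter_upwards [Lp.coeFn_smul c (W12.toL2 w), hu] with s h1 h2
  rw [h1, Pi.smul_apply, h2]

end Sobolev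

/-! ### The exponential functions `ε_z ⊗ x : σ ↦ e^{zσ} x` and the operators `Φ_z` -/

section Exponentials

variable {X : Type*} [NormedAddCommGroup X] [NormedSpace ℂ X]

theorem continuous_expFun (z : ℂ) (x : X) : Continuous fun s : ℝ => Complex.exp (z * s) • x := by
  fun_prop

theorem norm_exp_le (z : ℂ) : ∀ᵐ s : ℝ ∂μI, ‖Complex.exp (z * s)‖ ≤ Real.exp ‖z‖ := by
  filter_upwards [ae_restrict_mem measurableSet_Icc] with s hs
  rw [Complex.norm_exp]
  apply Real.exp_le_exp.2
  refine (Complex.re_le_norm _).trans ?_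
  rw [norm_mul, Complex.norm_real, Real.norm_eq_abs]
  have : |s| ≤ 1 := abs_le.2 ⟨hs.1, hs.2.trans zero_le_one⟩
  exact mul_le_of_le_one_right (norm_nonneg z) this

theorem memLp_expFun (z : ℂ) (x : X) :
    MemLp (fun s : ℝ => Complex.exp (z * s) • x) 2 μI := by
  refine MemLp.of_bound (continuous_expFun z x).aestronglyMeasurable (Real.exp ‖z‖ * ‖x‖) ?_
  filter_upwards [norm_exp_le z] with s hs
  rw [norm_smul]
  gcongr

/-- The function `σ ↦ e^{zσ} x` in `L²([-1, 0], X)`. -/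
def expL2 (z : ℂ) (x : X) : L2 X := (memLp_expFun z x).toLp _

theorem isWeakDeriv_expL2 [CompleteSpace X] (z : ℂ) (x : X) : IsWeakDeriv (expL2 z x) (z • expL2 z x) := by
  intro φ h1 h2 h3
  have hd : ∀ s : ℝ, HasDerivAt (fun s : ℝ => φ s • Complex.exp (z * s) • x)
      (φ s • z • Complex.exp (z * s) • x + deriv φ s • Complex.exp (z * s) • x) s := by
    intro s
    have e1 : HasDerivAt φ (deriv φ s) s := ((h1.differentiable (by simp)) s).hasDerivAt
    have e2 : HasDerivAt (fun s : ℝ => Complex.exp (z * s)) (Complex.exp (z * s) * z) s := by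
      have := ((hasDerivAt_id (s : ℂ)).const_mul z).cexp.comp_ofReal
      simpa using this
    have e3 := e1.smul (e2.smul_const x)
    rwa [mul_comm, mul_smul] at e3
  have c1 : Continuous (fun s : ℝ => φ s • z • Complex.exp (z * s) • x) :=
    h1.continuous.smul ((continuous_expFun z x).const_smul z)
  have c2 : Continuous (fun s : ℝ => deriv φ s • Complex.exp (z * s) • x) :=
    (h1.continuous_deriv (by simp)).smul (continuous_expFun z x)
  have b0 : φ 0 = 0 := image_eq_zero_of_notMem_tsupport (fun h => lt_irrefl _ (h3 h).2)
  have b1 : φ (-1) = 0 := image_eq_zero_of_notMem_tsupport (fun h => lt_irrefl _ (h3 h).1)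
  have hI := intervalIntegral.integral_eq_sub_of_hasDerivAt (a := (-1 : ℝ)) (b := 0)
    (fun s _ => hd s) ((c1.add c2).intervalIntegrable _ _)
  rw [intervalIntegral.integral_add (c1.intervalIntegrable _ _) (c2.intervalIntegrable _ _)] at hI
  rw [b0, b1, zero_smul, zero_smul, sub_zero] at hI
  have i1 : ∫ s, deriv φ s • expL2 z x s ∂μI
      = ∫ s in (-1 : ℝ)..0, deriv φ s • Complex.exp (z * s) • x := by
    rw [intervalIntegral.integral_of_le (by norm_num), ← integral_Icc_eq_integral_Ioc]
    apply integral_congr_ae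
    filter_upwards [(memLp_expFun z x).coeFn_toLp] with s hs
    rw [expL2, hs]
  have i2 : ∫ s, φ s • (z • expL2 z x) s ∂μI
      = ∫ s in (-1 : ℝ)..0, φ s • z • Complex.exp (z * s) • x := by
    rw [intervalIntegral.integral_of_le (by norm_num), ← integral_Icc_eq_integral_Ioc]
    apply integral_congr_ae
    filter_upwards [(memLp_expFun z x).coeFn_toLp, Lp.coeFn_smul z (expL2 z x)] with s hs hs'
    rw [hs', Pi.smul_apply, expL2, hs]
  rw [i1, i2, eq_neg_iff_add_eq_zero, add_comm]
  exact hI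

theorem expL2_add (z : ℂ) (x y : X) : expL2 z (x + y) = expL2 z x + expL2 z y := by
  rw [expL2, expL2, expL2, ← MemLp.toLp_add]
  congr 1
  funext s
  simp

theorem expL2_smul (z c : ℂ) (x : X) : expL2 z (c • x) = c • expL2 z x := by
  rw [expL2, expL2, ← MemLp.toLp_const_smul]
  congr 1
  funext s
  exact smul_comm _ _ _

theorem norm_expL2_le (z : ℂ) (x : X) : ‖expL2 z x‖ ≤
    measureUnivNNReal μI ^ (2 : ℝ≥0∞).toReal⁻¹ * Real.exp ‖z‖ * ‖x‖ := by
  rw [mul_assoc]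
  apply Lp.norm_le_of_ae_bound (by positivity)
  filter_upwards [(memLp_expFun z x).coeFn_toLp, norm_exp_le z] with s hs h
  rw [expL2, hs, norm_smul]
  gcongr

/-- `x ↦ ε_z ⊗ x` as a bounded operator `X → L²([-1, 0], X)`. -/
def expL2L (z : ℂ) : X →L[ℂ] L2 X :=
  LinearMap.mkContinuous
    { toFun := expL2 z
      map_add' := expL2_add z
      map_smul' := expL2_smul z } _ (norm_expL2_le z)

/-- `x ↦ ε_z ⊗ x` as a bounded operator `X → W^{1,2}([-1, 0], X)`. -/
def expW12 [CompleteSpace X] (z : ℂ) : X →L[ℂ] W12 X where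
  toFun x := ⟨WithLp.toLp 2 (expL2 z x, z • expL2 z x), isWeakDeriv_expL2 z x⟩
  map_add' x y := by
    apply Subtype.ext
    apply WithLp.ofLp_injective
    refine Prod.ext (expL2_add z x y) ?_
    change z • expL2 z (x + y) = z • expL2 z x + z • expL2 z y
    rw [expL2_add, smul_add]
  map_smul' c x := by
    apply Subtype.ext
    apply WithLp.ofLp_injective
    refine Prod.ext (expL2_smul z c x) ?_
    change z • expL2 z (c • x) = c • z • expL2 z x
    rw [expL2_smul, smul_comm]
  cont := by
    have h : Continuous fun x : X => expL2 z x := (expL2L z).continuous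
    exact ((WithLp.prod_continuous_toLp 2 (L2 X) (L2 X)).comp
      (h.prodMk (h.const_smul z))).subtype_mk _

/-- The operator `Φ_z x = Φ(e^{z ·} x)`. -/
def delaySymbol [CompleteSpace X] (Φ : W12 X →L[ℂ] X) (z : ℂ) : X →L[ℂ] X := Φ.comp (expW12 z)

end Exponentials

/-! ### The delay operator matrix, the nilpotent shift generator, admissibility -/

section Delay

variable (X : Type*) [NormedAddCommGroup X] [NormedSpace ℂ X] [CompleteSpace X]

/-- The state space `X × L²([-1, 0], X)` with the `2`-norm of the product. -/
abbrev StateSpace : Type _ := WithLp 2 (X × L2 X)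

/-- The operator `A₀ f = f'` on `L²([-1, 0], X)` with domain `{f ∈ W^{1,2} : f(0) = 0}`; it is the
generator of the nilpotent left shift semigroup. -/
def shiftGen : L2 X →ₗ.[ℂ] L2 X where
  domain :=
    { carrier := {f | ∃ w : W12 X, W12.toL2 w = f ∧ W12.HasValueAtZero w 0}
      zero_mem' := ⟨0, map_zero _, W12.HasValueAtZero.zero⟩
      add_mem' := by
        rintro _ _ ⟨w, rfl, hw⟩ ⟨w', rfl, hw'⟩
        exact ⟨w + w', map_add _ _ _, by simpa using hw.add hw'⟩
      smul_mem' := by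
        rintro c _ ⟨w, rfl, hw⟩
        exact ⟨c • w, map_smul _ _ _, by simpa using hw.smul c⟩ }
  toFun := W12.deriv.comp (W12.lift.comp
    (Submodule.inclusion (by rintro _ ⟨w, rfl, -⟩; exact ⟨w, rfl⟩)))

variable {X}

/-- The domain `{(x, f) ∈ D(B) × W^{1,2} : f(0) = x}` of the delay operator matrix. -/
def delayDomain (B : X →ₗ.[ℂ] X) : Submodule ℂ (StateSpace X) where
  carrier := {v | v.fst ∈ B.domain ∧ ∃ w : W12 X, W12.toL2 w = v.snd ∧ W12.HasValueAtZero w v.fst}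
  zero_mem' := ⟨B.domain.zero_mem, 0, map_zero _, W12.HasValueAtZero.zero⟩
  add_mem' := by
    rintro v v' ⟨hx, w, hw, h0⟩ ⟨hx', w', hw', h0'⟩
    exact ⟨B.domain.add_mem hx hx', w + w', by rw [map_add, hw, hw']; rfl, h0.add h0'⟩
  smul_mem' := by
    rintro c v ⟨hx, w, hw, h0⟩
    exact ⟨B.domain.smul_mem c hx, c • w, by rw [map_smul, hw]; rfl, h0.smul c⟩

/-- The first component of an element of the delay domain, in `D(B)`. -/
def delayFst (B : X →ₗ.[ℂ] X) : delayDomain B →ₗ[ℂ] B.domain :=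
  ((WithLp.fstₗ 2 ℂ X (L2 X)).comp (delayDomain B).subtype).codRestrict B.domain
    (fun v => v.2.1)

/-- The second component of an element of the delay domain, in `W^{1,2}`. -/
def delaySnd (B : X →ₗ.[ℂ] X) : delayDomain B →ₗ[ℂ] W12 X :=
  W12.lift.comp (((WithLp.sndₗ 2 ℂ X (L2 X)).comp (delayDomain B).subtype).codRestrict
    (LinearMap.range W12.toL2) (fun v => ⟨v.2.2.choose, v.2.2.choose_spec.1⟩))

/-- The delay operator matrix `(x, f) ↦ (B x + Φ f, f')`
with domain `{(x, f) ∈ D(B) × W^{1,2} : f(0) = x}`. -/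
def delayOperator (B : X →ₗ.[ℂ] X) (Φ : W12 X →L[ℂ] X) : StateSpace X →ₗ.[ℂ] StateSpace X where
  domain := delayDomain B
  toFun := (WithLp.linearEquiv 2 ℂ (X × L2 X)).symm.toLinearMap.comp
    ((B.toFun.comp (delayFst B) + (Φ : W12 X →ₗ[ℂ] X).comp (delaySnd B)).prod
      (W12.deriv.comp (delaySnd B)))

/-- `Φ` is admissible: (a) the delay operator matrix is a generator whenever `B` is, and
(b) `z ↦ Φ R(z, A₀)` is (given by bounded operators `F z` and is) a bounded analytic function on
every right half plane. -/
def Admissible (Φ : W12 X →L[ℂ] X) : Prop :=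
  (∀ B : X →ₗ.[ℂ] X, IsGenerator B → IsGenerator (delayOperator B Φ)) ∧
  ∃ F : ℂ → (L2 X →L[ℂ] X),
    (∀ (z : ℂ) (f : L2 X), ∃ w : W12 X,
      W12.toL2 w = resolvent (shiftGen X) z f ∧ F z f = Φ w) ∧
    ∀ ω : ℝ, AnalyticOnNhd ℂ F {z : ℂ | ω < z.re} ∧
      ∃ M : ℝ, ∀ z : ℂ, ω < z.re → ‖F z‖ ≤ M

end Delay

end DelayEq

end

/-! On a Hilbert space, hyperbolicity of a semigroup is equivalent to a bounded resolvent of its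
generator on the imaginary axis (Gearhart–Prüss). The proof transfers this resolvent bound from $B$
to $\mathcal A$.

For $z\in i\mathbb R$, solving $(z-\mathcal A)(c,f)=(x,g)$ forces $f=e^{z\cdot}c+R(z,A_0)g$ and
$c=R(z,B)(1-\Phi_zR(z,B))^{-1}(x+\Phi R(z,A_0)g)$. The inverse is a Neumann series, bounded by
$(1-q)^{-1}$ with $q=\sup_\omega\|\Phi_{i\omega}R(i\omega,B)\|<1$; $R(z,B)$ is bounded because $B$
is hyperbolic, $R(z,A_0)$ is a contraction, and $\Phi R(z,A_0)$ is bounded by admissibility. This is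
`exists_isResolventAt_delayOperator`. The $2$-norms make $X\times L^2$ a Hilbert space, so
Gearhart–Prüss applies to $\mathcal A$.

Hyperbolicity gives a bounded resolvent (`IsGeneratorOf.exists_resolvent`): $1-e^{-zb}T(b)$ is
uniformly invertible for one large $b$, and composing the inverse with $\int_0^be^{-zt}T(t)\,dt$
gives $R(z,B)$.

The converse (`IsGeneratorOf.isHyperbolic`) has two steps. The Fourier coefficients of $t\mapsto
e^{-zt}T(t)x$ on $[0,1]$ are resolvents applied to $x-e^{-z}T(1)x$; Plancherel and the resolvent
identity then show that $1-e^{-z}T(1)$ is invertible (`IsGeneratorOf.isUnit_one_sub`). Finally, the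
Fourier coefficients of $(1-e^{-2\pi iv}T(1))^{-1}$ yield the splitting (`exists_dichotomy`). -/

namespace DelayEq

/-! ### Semigroups, generators and truncated Laplace transforms. -/

section SemigroupBasics

variable {E : Type*} [NormedAddCommGroup E] [NormedSpace ℂ E]

namespace C0Semigroup

theorem T_add_apply (S : C0Semigroup E) {s t : ℝ} (hs : 0 ≤ s) (ht : 0 ≤ t) (x : E) :
    S.T (s + t) x = S.T s (S.T t x) := by
  rw [S.add s t hs ht]; rfl

theorem T_zero_apply (S : C0Semigroup E) (x : E) : S.T 0 x = x := by
  rw [S.zero]; rfl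

theorem commute (S : C0Semigroup E) {s t : ℝ} (hs : 0 ≤ s) (ht : 0 ≤ t) :
    Commute (S.T s) (S.T t) := by
  change (S.T s).comp (S.T t) = (S.T t).comp (S.T s)
  rw [← S.add s t hs ht, ← S.add t s ht hs, add_comm]

theorem T_nat_mul (S : C0Semigroup E) {t : ℝ} (ht : 0 ≤ t) (n : ℕ) :
    S.T (n * t) = S.T t ^ n := by
  induction n with
  | zero => rw [Nat.cast_zero, zero_mul, pow_zero, S.zero]; rfl
  | succ n ih =>
    rw [Nat.cast_succ, add_one_mul, S.add _ _ (by positivity) ht, ih, pow_succ]; rfl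

theorem exists_norm_le [CompleteSpace E] (S : C0Semigroup E) (b : ℝ) :
    ∃ K : ℝ, 1 ≤ K ∧ ∀ t ∈ Icc 0 b, ‖S.T t‖ ≤ K := by
  obtain ⟨C, hC⟩ := banach_steinhaus (g := fun t : Icc (0 : ℝ) b => S.T t) (fun x => by
    obtain ⟨C, hC⟩ := (isCompact_Icc (a := (0 : ℝ)) (b := b)).exists_bound_of_continuousOn
      ((S.cont x).mono Icc_subset_Ici_self)
    exact ⟨C, fun t => hC t t.2⟩)
  exact ⟨max C 1, le_max_right _ _, fun t ht => (hC ⟨t, ht⟩).trans (le_max_left _ _)⟩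

/-- The function `t ↦ e^{-zt} T(t) x`, extended by a constant to `t < 0`. -/
noncomputable def rescaledOrbit (S : C0Semigroup E) (z : ℂ) (x : E) (t : ℝ) : E :=
  Complex.exp (-z * (max t 0 : ℝ)) • S.T (max t 0) x

theorem rescaledOrbit_of_nonneg (S : C0Semigroup E) (z : ℂ) (x : E) {t : ℝ} (ht : 0 ≤ t) :
    S.rescaledOrbit z x t = Complex.exp (-z * t) • S.T t x := by
  rw [rescaledOrbit, max_eq_left ht]

theorem continuous_rescaledOrbit (S : C0Semigroup E) (z : ℂ) (x : E) :
    Continuous (S.rescaledOrbit z x) := by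
  have h : Continuous fun t : ℝ => S.T (max t 0) x :=
    (S.cont x).comp_continuous (continuous_id.max continuous_const) (fun t => mem_Ici.2 (le_max_right t 0))
  unfold rescaledOrbit
  fun_prop

theorem T_rescaledOrbit (S : C0Semigroup E) (z : ℂ) (x : E) {h t : ℝ} (hh : 0 ≤ h) (ht : 0 ≤ t) :
    S.T h (S.rescaledOrbit z x t) = Complex.exp (z * h) • S.rescaledOrbit z x (t + h) := by
  rw [rescaledOrbit_of_nonneg _ _ _ ht, rescaledOrbit_of_nonneg _ _ _ (add_nonneg ht hh), map_smul,
    smul_smul, ← Complex.exp_add, add_comm t h, T_add_apply _ hh ht]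
  congr 2
  push_cast
  ring

theorem norm_integral_rescaledOrbit_le (S : C0Semigroup E) {b K : ℝ} (hb : 0 ≤ b)
    (hK : ∀ t ∈ Icc 0 b, ‖S.T t‖ ≤ K) {z : ℂ} (hz : 0 ≤ z.re) (x : E) :
    ‖∫ t in (0 : ℝ)..b, S.rescaledOrbit z x t‖ ≤ K * b * ‖x‖ := by
  have := intervalIntegral.norm_integral_le_of_norm_le_const (a := (0 : ℝ)) (b := b)
    (f := S.rescaledOrbit z x) (C := K * ‖x‖) (by
      intro t ht
      rw [uIoc_of_le hb] at ht
      rw [rescaledOrbit_of_nonneg _ _ _ ht.1.le, norm_smul, Complex.norm_exp]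
      have h1 : Real.exp (-z * t : ℂ).re ≤ 1 := by
        rw [Real.exp_le_one_iff]
        simp
        exact mul_nonneg hz ht.1.le
      have h2 : ‖S.T t x‖ ≤ K * ‖x‖ :=
        ((S.T t).le_opNorm x).trans (by gcongr; exact hK t ⟨ht.1.le, ht.2⟩)
      calc _ ≤ 1 * (K * ‖x‖) := by gcongr
        _ = _ := one_mul _)
  rw [sub_zero, abs_of_nonneg hb] at this
  linarith

/-- The truncated Laplace transform of a semigroup is a bounded operator. -/
theorem exists_truncatedLaplace (S : C0Semigroup E) {b K : ℝ} (hb : 0 ≤ b)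
    (hK : ∀ t ∈ Icc 0 b, ‖S.T t‖ ≤ K) {z : ℂ} (hz : 0 ≤ z.re) :
    ∃ V : E →L[ℂ] E, ‖V‖ ≤ K * b ∧ ∀ x, V x = ∫ t in (0 : ℝ)..b, S.rescaledOrbit z x t := by
  have hK0 : 0 ≤ K := (norm_nonneg _).trans (hK 0 ⟨le_rfl, hb⟩)
  refine ⟨LinearMap.mkContinuous
    { toFun := fun x => ∫ t in (0 : ℝ)..b, S.rescaledOrbit z x t
      map_add' := fun x y => ?_
      map_smul' := fun c x => ?_ } (K * b) (S.norm_integral_rescaledOrbit_le hb hK hz),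
    LinearMap.mkContinuous_norm_le _ (by positivity) _, fun x => rfl⟩
  · rw [← intervalIntegral.integral_add
      ((S.continuous_rescaledOrbit z x).intervalIntegrable _ _)
      ((S.continuous_rescaledOrbit z y).intervalIntegrable _ _)]
    congr 1
    funext t
    simp [rescaledOrbit]
  · rw [RingHom.id_apply, ← intervalIntegral.integral_smul]
    congr 1
    funext t
    simp only [rescaledOrbit, map_smul]
    exact smul_comm _ _ _

variable [CompleteSpace E]

theorem T_integral_rescaledOrbit (S : C0Semigroup E) (z : ℂ) (x : E) {b h : ℝ} (hb : 0 ≤ b)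
    (hh : 0 ≤ h) : S.T h (∫ t in (0 : ℝ)..b, S.rescaledOrbit z x t) =
      Complex.exp (z * h) • ∫ t in h..(b + h), S.rescaledOrbit z x t := by
  rw [← ContinuousLinearMap.intervalIntegral_comp_comm _
    ((S.continuous_rescaledOrbit z x).intervalIntegrable _ _), ← intervalIntegral.integral_smul]
  have e : ∫ t in (0 : ℝ)..b, S.T h (S.rescaledOrbit z x t) =
      ∫ t in (0 : ℝ)..b, Complex.exp (z * h) • S.rescaledOrbit z x (t + h) := by
    apply intervalIntegral.integral_congr
    intro t ht
    rw [uIcc_of_le hb] at ht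
    exact S.T_rescaledOrbit z x hh ht.1
  rw [e, intervalIntegral.integral_comp_add_right
    (fun t => Complex.exp (z * h) • S.rescaledOrbit z x t), zero_add]

/-- With $f(t)=e^{-zt}T(t)x$, the semigroup law gives $T(h)\int_0^bf=e^{zh}\int_h^{b+h}f$. The
product rule at $h=0$ yields $z\int_0^bf+f(b)-f(0)$. The constant extension of $f$ to $t<0$ makes
this an ordinary two-sided derivative. -/
theorem tendsto_integral_rescaledOrbit (S : C0Semigroup E) (z : ℂ) (x : E) {b : ℝ} (hb : 0 ≤ b) :
    Tendsto (fun h : ℝ => (h : ℂ)⁻¹ • (S.T h (∫ t in (0 : ℝ)..b, S.rescaledOrbit z x t) -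
      ∫ t in (0 : ℝ)..b, S.rescaledOrbit z x t)) (𝓝[>] 0)
      (𝓝 (z • (∫ t in (0 : ℝ)..b, S.rescaledOrbit z x t) -
        (x - Complex.exp (-z * b) • S.T b x))) := by
  set f := S.rescaledOrbit z x with hf
  have hc : Continuous f := S.continuous_rescaledOrbit z x
  have hF : ∀ t, HasDerivAt (fun t => ∫ s in (0 : ℝ)..t, f s) (f t) t := fun t =>
    intervalIntegral.integral_hasDerivAt_right (hc.intervalIntegrable _ _)
      (hc.stronglyMeasurableAtFilter _ _) hc.continuousAt
  have h1 : HasDerivAt (fun h : ℝ => (∫ s in (0 : ℝ)..(b + h), f s) - ∫ s in (0 : ℝ)..h, f s)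
      (f b - f 0) 0 := by
    have := (hF (b + 0)).scomp_of_eq (h := fun h : ℝ => b + h) (0 : ℝ)
      ((hasDerivAt_id (0 : ℝ)).const_add b) rfl
    have := this.sub (hF 0)
    rw [add_zero, one_smul] at this
    exact this
  have h2 : HasDerivAt (fun h : ℝ => Complex.exp (z * h)) z 0 := by
    have := (((hasDerivAt_id (0 : ℂ)).const_mul z).cexp).comp_ofReal (z := (0 : ℝ))
    simpa using this
  have h3 := (h2.smul h1).tendsto_slope_zero_right
  have e0 : f 0 = x := by
    rw [hf, rescaledOrbit_of_nonneg _ _ _ le_rfl, T_zero_apply]; simp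
  have eb : f b = Complex.exp (-z * b) • S.T b x := by
    rw [hf, rescaledOrbit_of_nonneg _ _ _ hb]
  have h4 : z • (∫ t in (0 : ℝ)..b, f t) - (x - Complex.exp (-z * b) • S.T b x) =
      Complex.exp (z * (0 : ℝ)) • (f b - f 0) +
        z • ((∫ s in (0 : ℝ)..(b + 0), f s) - ∫ s in (0 : ℝ)..0, f s) := by
    rw [e0, eb]
    simp
    abel
  rw [h4]
  refine h3.congr' ?_
  filter_upwards [self_mem_nhdsWithin] with h hh
  have hh' : (0 : ℝ) < h := hh
  rw [S.T_integral_rescaledOrbit z x hb hh'.le, zero_add]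
  simp only [Pi.smul_apply']
  rw [intervalIntegral.integral_interval_sub_left (hc.intervalIntegrable _ _)
    (hc.intervalIntegrable _ _)]
  simp only [intervalIntegral.integral_same, add_zero, Complex.ofReal_zero, mul_zero,
    Complex.exp_zero, one_smul, sub_zero]
  rw [← Complex.ofReal_inv, Complex.coe_smul, ← hf]

end C0Semigroup

variable {A : E →ₗ.[ℂ] E} {S : C0Semigroup E}

theorem IsGeneratorOf.tendsto (hA : IsGeneratorOf A S) (u : A.domain) :
    Tendsto (fun t : ℝ => (t : ℂ)⁻¹ • (S.T t u - u)) (𝓝[>] 0) (𝓝 (A u)) :=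
  (hA u (A u)).1 ⟨u.2, rfl⟩

theorem IsResolventAt.eq {z : ℂ} {R R' : E →L[ℂ] E} (h : IsResolventAt A z R)
    (h' : IsResolventAt A z R') : R = R' := by
  ext y
  obtain ⟨hy, e⟩ := h'.1 y
  have := h.2 ⟨R' y, hy⟩
  rwa [e] at this

theorem IsResolventAt.resolvent_eq {z : ℂ} {R : E →L[ℂ] E} (h : IsResolventAt A z R) :
    resolvent A z = R := by
  have hex : ∃ R : E →L[ℂ] E, IsResolventAt A z R := ⟨R, h⟩
  rw [resolvent, dif_pos hex]
  exact hex.choose_spec.eq h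

variable [CompleteSpace E]

/-- Together with `truncatedLaplace_apply`, this links the resolvent of $A$ at $z$ to the
invertibility of the bounded operator $1-e^{-zb}T(b)$. -/
theorem IsGeneratorOf.integral_rescaledOrbit (hA : IsGeneratorOf A S) (z : ℂ) (x : E) {b : ℝ}
    (hb : 0 ≤ b) : ∃ hv : (∫ t in (0 : ℝ)..b, S.rescaledOrbit z x t) ∈ A.domain,
      z • (∫ t in (0 : ℝ)..b, S.rescaledOrbit z x t) - A ⟨_, hv⟩ =
        x - Complex.exp (-z * b) • S.T b x := by
  obtain ⟨hv, h⟩ := (hA _ _).2 (S.tendsto_integral_rescaledOrbit z x hb)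
  exact ⟨hv, by rw [h]; abel⟩

/-- $V$ commutes with $T(h)$, so $VAu$ is the limit of the difference quotients of $Vu$; that limit
is also known from `tendsto_integral_rescaledOrbit`. -/
theorem IsGeneratorOf.truncatedLaplace_apply (hA : IsGeneratorOf A S) {z : ℂ} {b : ℝ}
    (hb : 0 ≤ b) {V : E →L[ℂ] E} (hV : ∀ x, V x = ∫ t in (0 : ℝ)..b, S.rescaledOrbit z x t)
    (u : A.domain) :
    V (z • (u : E) - A u) = (u : E) - Complex.exp (-z * b) • S.T b u := by
  have h1 : Tendsto (fun h : ℝ => (h : ℂ)⁻¹ • (S.T h (V u) - V u)) (𝓝[>] 0) (𝓝 (V (A u))) := by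
    refine ((V.continuous.tendsto _).comp (hA.tendsto u)).congr' ?_
    filter_upwards [self_mem_nhdsWithin] with h hh
    have hh' : (0 : ℝ) < h := hh
    rw [Function.comp_apply, map_smul, map_sub]
    congr 2
    rw [hV u, hV, ← ContinuousLinearMap.intervalIntegral_comp_comm _
      ((S.continuous_rescaledOrbit z _).intervalIntegrable _ _)]
    apply intervalIntegral.integral_congr
    intro t ht
    rw [uIcc_of_le hb] at ht
    have hc : S.T t (S.T h u) = S.T h (S.T t u) :=
      DFunLike.congr_fun (S.commute ht.1 hh'.le) (u : E)
    simp only [S.rescaledOrbit_of_nonneg _ _ ht.1, map_smul, hc]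
  have h2 := S.tendsto_integral_rescaledOrbit z (u : E) hb
  rw [← hV] at h2
  rw [map_sub, map_smul, tendsto_nhds_unique h1 h2]
  abel

end SemigroupBasics

/-! ### Invertibility criterion and Plancherel theorem in Hilbert spaces. -/

section Hilbert

variable {H : Type*} [NormedAddCommGroup H] [InnerProductSpace ℂ H]

/-- A bounded operator on a Hilbert space that is bounded below and whose range has trivial
orthogonal complement is invertible. -/
theorem exists_inverse_of_bounded_below [CompleteSpace H] (T : H →L[ℂ] H) {C : ℝ} (hC : 0 ≤ C)
    (hT : ∀ x, ‖x‖ ≤ C * ‖T x‖) (hd : ∀ φ : H, (∀ x, inner ℂ φ (T x) = 0) → φ = 0) :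
    ∃ W : H →L[ℂ] H, W * T = 1 ∧ T * W = 1 ∧ ‖W‖ ≤ C := by
  have hanti : AntilipschitzWith C.toNNReal T := by
    apply AddMonoidHomClass.antilipschitz_of_bound
    intro x
    rw [Real.coe_toNNReal C hC]
    exact hT x
  have hb : Function.Bijective T := by
    rw [ContinuousLinearMap.bijective_iff_dense_range_and_antilipschitz]
    refine ⟨?_, _, hanti⟩
    rw [Submodule.topologicalClosure_eq_top_iff, Submodule.eq_bot_iff]
    intro φ hφ
    rw [Submodule.mem_orthogonal'] at hφ
    exact hd φ fun x => hφ _ ⟨x, rfl⟩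
  let e := ContinuousLinearEquiv.ofBijective T (LinearMap.ker_eq_bot.2 hb.1)
    (LinearMap.range_eq_top.2 hb.2)
  have h1 : ∀ x, T (e.symm x) = x := e.apply_symm_apply
  have h2 : ∀ x, e.symm (T x) = x := e.symm_apply_apply
  refine ⟨(e.symm : H →L[ℂ] H), ?_, ?_, ?_⟩
  · ext x; exact h2 x
  · ext x; exact h1 x
  · refine ContinuousLinearMap.opNorm_le_bound _ hC fun x => ?_
    have := hT (e.symm x)
    rwa [h1] at this

theorem exists_orthonormal_of_finiteDimensional (V : Submodule ℂ H) [FiniteDimensional ℂ V] :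
    ∃ (n : ℕ) (v : Fin n → H), Orthonormal ℂ v ∧
      ∀ x, ∑ j, ‖inner ℂ (v j) x‖ ^ 2 = ‖V.orthogonalProjectionOnto x‖ ^ 2 := by
  refine ⟨_, fun j => (stdOrthonormalBasis ℂ V j : H), ?_, fun x => ?_⟩
  · exact (stdOrthonormalBasis ℂ V).orthonormal.comp_linearIsometry V.subtypeₗᵢ
  · rw [← (stdOrthonormalBasis ℂ V).sum_sq_norm_inner_right]
    simp

/-- The `k`-th Fourier coefficient of a function on `[0, 1]`. -/
noncomputable def unitFourierCoeff {F : Type*} [NormedAddCommGroup F] [NormedSpace ℂ F]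
    (f : ℝ → F) (k : ℤ) : F :=
  ∫ t in (0 : ℝ)..1, Complex.exp (-(2 * Real.pi * k * Complex.I) * t) • f t

theorem inner_unitFourierCoeff [CompleteSpace H] {f : ℝ → H} (hf : Continuous f) (v : H) (k : ℤ) :
    inner ℂ v (unitFourierCoeff f k) = unitFourierCoeff (fun t => inner ℂ v (f t)) k := by
  have h := ContinuousLinearMap.intervalIntegral_comp_comm (innerSL ℂ v)
    (f := fun t : ℝ => Complex.exp (-(2 * Real.pi * k * Complex.I) * t) • f t)
    (μ := volume) (a := 0) (b := 1) (by
      apply Continuous.intervalIntegrable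
      fun_prop)
  simp only [innerSL_apply_apply, inner_smul_right] at h
  exact h.symm

theorem hasSum_sq_unitFourierCoeff {g : ℝ → ℂ} (hg : Continuous g) :
    HasSum (fun k : ℤ => ‖unitFourierCoeff g k‖ ^ 2) (∫ t in (0 : ℝ)..1, ‖g t‖ ^ 2) := by
  have hL : MemLp g 2 (volume.restrict (Ioc (0 : ℝ) 1)) := by
    obtain ⟨C, hC⟩ := (isCompact_Icc (a := (0 : ℝ)) (b := 1)).exists_bound_of_continuousOn
      hg.continuousOn
    refine MemLp.of_bound hg.aestronglyMeasurable C ?_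
    filter_upwards [ae_restrict_mem measurableSet_Ioc] with t ht
    exact hC t (Ioc_subset_Icc_self ht)
  have h := hasSum_sq_fourierCoeffOn zero_lt_one hL
  simp only [sub_zero, inv_one, one_smul] at h
  convert h using 3 with k
  rw [fourierCoeffOn_eq_integral]
  simp only [sub_zero, div_one, one_smul, unitFourierCoeff]
  congr 2
  funext t
  congr 1
  rw [fourier_coe_apply]
  congr 1
  push_cast
  ring

theorem intervalIntegrable_norm_sq {F : Type*} [NormedAddCommGroup F] {f : ℝ → F}
    (hf : Continuous f) (a b : ℝ) : IntervalIntegrable (fun t => ‖f t‖ ^ 2) volume a b :=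
  (hf.norm.pow 2).intervalIntegrable _ _

/-- Bessel's inequality for Fourier coefficients of Hilbert space valued functions. -/
theorem sum_sq_unitFourierCoeff_le [CompleteSpace H] {f : ℝ → H} (hf : Continuous f)
    (s : Finset ℤ) :
    ∑ k ∈ s, ‖unitFourierCoeff f k‖ ^ 2 ≤ ∫ t in (0 : ℝ)..1, ‖f t‖ ^ 2 := by
  classical
  -- The finitely many coefficients span a finite-dimensional space; expanding in an orthonormal
  -- basis of it reduces the claim to scalar Parseval, with no separability of $H$.
  let V : Submodule ℂ H := Submodule.span ℂ (s.image (unitFourierCoeff f) : Set H)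
  have : FiniteDimensional ℂ V := FiniteDimensional.span_finset ℂ _
  obtain ⟨n, v, hv, hV⟩ := exists_orthonormal_of_finiteDimensional V
  have hcont : ∀ j, Continuous fun t => inner ℂ (v j) (f t) := fun j => by fun_prop
  calc ∑ k ∈ s, ‖unitFourierCoeff f k‖ ^ 2
      = ∑ k ∈ s, ∑ j, ‖unitFourierCoeff (fun t => inner ℂ (v j) (f t)) k‖ ^ 2 := by
        refine Finset.sum_congr rfl fun k hk => ?_
        have hm : unitFourierCoeff f k ∈ V :=
          Submodule.subset_span (by simpa using ⟨k, hk, rfl⟩)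
        simp_rw [← inner_unitFourierCoeff hf]
        rw [hV]
        have := V.orthogonalProjectionOnto_mem_subspace_eq_self ⟨_, hm⟩
        rw [this]; rfl
    _ = ∑ j, ∑ k ∈ s, ‖unitFourierCoeff (fun t => inner ℂ (v j) (f t)) k‖ ^ 2 :=
        Finset.sum_comm
    _ ≤ ∑ j, ∫ t in (0 : ℝ)..1, ‖inner ℂ (v j) (f t)‖ ^ 2 := by
        refine Finset.sum_le_sum fun j _ => ?_
        exact sum_le_hasSum s (fun _ _ => by positivity) (hasSum_sq_unitFourierCoeff (hcont j))
    _ = ∫ t in (0 : ℝ)..1, ∑ j, ‖inner ℂ (v j) (f t)‖ ^ 2 :=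
        (intervalIntegral.integral_finsetSum fun j _ =>
          intervalIntegrable_norm_sq (hcont j) _ _).symm
    _ ≤ ∫ t in (0 : ℝ)..1, ‖f t‖ ^ 2 := by
        refine intervalIntegral.integral_mono_on zero_le_one ?_
          (intervalIntegrable_norm_sq hf _ _) fun t _ => hv.sum_inner_products_le _
        exact Continuous.intervalIntegrable (by fun_prop) _ _

/-- Completeness of the trigonometric system for Hilbert space valued functions. -/
theorem integral_norm_sq_le_of_sum_sq_unitFourierCoeff_le [CompleteSpace H] {f : ℝ → H}
    (hf : Continuous f) {C : ℝ} (hC : ∀ s : Finset ℤ, ∑ k ∈ s, ‖unitFourierCoeff f k‖ ^ 2 ≤ C) :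
    ∫ t in (0 : ℝ)..1, ‖f t‖ ^ 2 ≤ C := by
  refine le_of_forall_pos_le_add fun δ hδ => ?_
  obtain ⟨ε, hε, hεδ⟩ : ∃ ε : ℝ, 0 < ε ∧ ε ^ 2 = δ :=
    ⟨Real.sqrt δ, Real.sqrt_pos.2 hδ, Real.sq_sqrt hδ.le⟩
  -- The compact set $f([0,1])$ lies within $\varepsilon$ of a finite-dimensional $V$, so discarding
  -- the component orthogonal to $V$ costs at most $\varepsilon^2=\delta$.
  obtain ⟨N, -, hN, hcov⟩ := Metric.finite_approx_of_totallyBounded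
    ((isCompact_Icc (a := (0 : ℝ)) (b := 1)).image hf).totallyBounded ε hε
  let V : Submodule ℂ H := Submodule.span ℂ N
  have : FiniteDimensional ℂ V := FiniteDimensional.span_of_finite ℂ hN
  obtain ⟨n, v, hv, hV⟩ := exists_orthonormal_of_finiteDimensional V
  have hcont : ∀ j, Continuous fun t => inner ℂ (v j) (f t) := fun j => by fun_prop
  have hle : ∀ t ∈ Icc (0 : ℝ) 1, ‖f t‖ ^ 2 ≤ (∑ j, ‖inner ℂ (v j) (f t)‖ ^ 2) + δ := by
    intro t ht
    obtain ⟨p, hp, hpt⟩ := mem_iUnion₂.1 (hcov (mem_image_of_mem f ht))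
    rw [V.norm_sq_eq_add_norm_sq_projection (f t), hV, ← hεδ]
    have h0 : Vᗮ.orthogonalProjectionOnto p = 0 := by
      rw [Submodule.orthogonalProjectionOnto_eq_zero_iff]
      exact V.le_orthogonal_orthogonal (Submodule.subset_span hp)
    have h1 : Vᗮ.orthogonalProjectionOnto (f t) = Vᗮ.orthogonalProjectionOnto (f t - p) := by
      rw [map_sub, h0, sub_zero]
    have h2 : ‖Vᗮ.orthogonalProjectionOnto (f t)‖ ≤ ε := by
      rw [h1]
      refine (Submodule.norm_orthogonalProjectionOnto_apply_le _ _).trans ?_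
      rw [← dist_eq_norm]
      exact (Metric.mem_ball.1 hpt).le
    gcongr
  calc ∫ t in (0 : ℝ)..1, ‖f t‖ ^ 2
      ≤ ∫ t in (0 : ℝ)..1, ((∑ j, ‖inner ℂ (v j) (f t)‖ ^ 2) + δ) := by
        refine intervalIntegral.integral_mono_on zero_le_one
          (intervalIntegrable_norm_sq hf _ _) ?_ hle
        exact Continuous.intervalIntegrable (by fun_prop) _ _
    _ = (∑ j, ∫ t in (0 : ℝ)..1, ‖inner ℂ (v j) (f t)‖ ^ 2) + δ := by
        rw [intervalIntegral.integral_add, intervalIntegral.integral_finsetSum]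
        · simp
        · exact fun j _ => intervalIntegrable_norm_sq (hcont j) _ _
        · exact Continuous.intervalIntegrable (by fun_prop) _ _
        · exact intervalIntegrable_const
    _ ≤ C + δ := by
        gcongr
        have hs := hasSum_sum (s := Finset.univ)
          fun (j : Fin n) _ => hasSum_sq_unitFourierCoeff (hcont j)
        refine hasSum_le_of_sum_le hs fun s => ?_
        refine le_trans ?_ (hC s)
        refine Finset.sum_le_sum fun k _ => ?_
        simp_rw [← inner_unitFourierCoeff hf]
        exact hv.sum_inner_products_le _

end Hilbert

/-! ### From a bounded resolvent on $i\mathbb R$ to the unit circle in the resolvent set of $T(1)$.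
-/

section UnitCircle

theorem exists_sub_apply_eq {E : Type*} [NormedAddCommGroup E] [NormedSpace ℂ E] [CompleteSpace E]
    {N : E →L[ℂ] E} (hN : ‖N‖ ≤ 1 / 2) (y : E) : ∃ z, z - N z = y ∧ ‖z‖ ≤ 2 * ‖y‖ := by
  have hN1 : ‖N‖ < 1 := hN.trans_lt (by norm_num)
  let u := Units.oneSub N hN1
  have hu : (u : E →L[ℂ] E) * (↑u⁻¹ : E →L[ℂ] E) = 1 := u.mul_inv
  have h1 : (↑u⁻¹ : E →L[ℂ] E) y - N ((↑u⁻¹ : E →L[ℂ] E) y) = y := DFunLike.congr_fun hu y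
  refine ⟨_, h1, ?_⟩
  set z := (↑u⁻¹ : E →L[ℂ] E) y
  have h2 : ‖z‖ ≤ ‖y‖ + ‖N z‖ := by
    calc ‖z‖ = ‖y + N z‖ := by rw [← h1]; simp
      _ ≤ _ := norm_add_le _ _
  have h3 : ‖N z‖ ≤ 1 / 2 * ‖z‖ := N.le_of_opNorm_le hN z
  linarith

/-- This is the resolvent identity with $d$ in the role of $R(\zeta,A)y$; it does not require
$\zeta$ to be in the resolvent set. -/
theorem IsResolventAt.apply_of_shift {E : Type*} [NormedAddCommGroup E] [NormedSpace ℂ E]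
    {A : E →ₗ.[ℂ] E} {z w ζ : ℂ} {R : E →L[ℂ] E} (hR : IsResolventAt A z R) (hζ : ζ = w + z)
    {d y : E} (hd : d ∈ A.domain) (h : ζ • d - A ⟨d, hd⟩ = y) : R y = d + w • R d := by
  have h1 := hR.2 ⟨d, hd⟩
  have h2 : y = w • d + (z • d - A ⟨d, hd⟩) := by
    rw [← h, hζ, add_smul]
    abel
  rw [h2, map_add, map_smul, h1, add_comm]

variable {H : Type*} [NormedAddCommGroup H] [InnerProductSpace ℂ H] [CompleteSpace H]
  {A : H →ₗ.[ℂ] H} {S : C0Semigroup H}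

omit [CompleteSpace H] in
theorem C0Semigroup.unitFourierCoeff_rescaledOrbit (S : C0Semigroup H) (z : ℂ) (x : H) (k : ℤ) :
    unitFourierCoeff (S.rescaledOrbit z x) k =
      ∫ t in (0 : ℝ)..1, S.rescaledOrbit (z + 2 * Real.pi * k * Complex.I) x t := by
  refine intervalIntegral.integral_congr fun t ht => ?_
  rw [uIcc_of_le zero_le_one] at ht
  simp only [S.rescaledOrbit_of_nonneg _ _ ht.1, smul_smul, ← Complex.exp_add]
  congr 2
  ring

/-- Consequently the boundary term $x-e^{-z}T(1)x$ of the Laplace transform over $[0,1]$ is the same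
for all Fourier modes $k$. -/
theorem exp_neg_add_two_pi_mul (z : ℂ) (k : ℤ) :
    Complex.exp (-(z + 2 * Real.pi * k * Complex.I) * (1 : ℝ)) = Complex.exp (-z) := by
  rw [show -(z + 2 * Real.pi * k * Complex.I) * (1 : ℝ) =
    -z + ((-k : ℤ) : ℂ) * (2 * Real.pi * Complex.I) by push_cast; ring]
  rw [Complex.exp_add, Complex.exp_int_mul_two_pi_mul_I, mul_one]

omit [CompleteSpace H] in
theorem C0Semigroup.integral_norm_sq_rescaledOrbit_le (S : C0Semigroup H) {K : ℝ}
    (hK : ∀ t ∈ Icc (0 : ℝ) 1, ‖S.T t‖ ≤ K) {z : ℂ} (hz : 0 ≤ z.re) (x : H) :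
    ∫ t in (0 : ℝ)..1, ‖S.rescaledOrbit z x t‖ ^ 2 ≤ (K * ‖x‖) ^ 2 := by
  have h := intervalIntegral.integral_mono_on (μ := volume) zero_le_one
    (intervalIntegrable_norm_sq (S.continuous_rescaledOrbit z x) 0 1)
    (intervalIntegrable_const (c := (K * ‖x‖) ^ 2)) (fun t ht => by
      have h1 : ‖Complex.exp (-z * t)‖ ≤ 1 := by
        rw [Complex.norm_exp, Real.exp_le_one_iff]
        simpa using mul_nonneg hz ht.1
      have h2 := (S.T t).le_of_opNorm_le (hK t ht) x
      rw [S.rescaledOrbit_of_nonneg _ _ ht.1, norm_smul]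
      refine pow_le_pow_left₀ (by positivity) ?_ 2
      calc _ ≤ 1 * (K * ‖x‖) := by gcongr
        _ = _ := one_mul _)
  simpa using h

-- $T(1)x=T(1-t)T(t)x$ bounds $\|T(1)x\|$ by $K\|T(t)x\|$ for every $t\in[0,1]$; then integrate the
-- squares over $t$.
omit [CompleteSpace H] in
theorem C0Semigroup.norm_sq_T_one_le (S : C0Semigroup H) {K : ℝ}
    (hK : ∀ t ∈ Icc (0 : ℝ) 1, ‖S.T t‖ ≤ K) {z : ℂ} (hz : z.re = 0) (x : H) :
    ‖S.T 1 x‖ ^ 2 ≤ K ^ 2 * ∫ t in (0 : ℝ)..1, ‖S.rescaledOrbit z x t‖ ^ 2 := by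
  rw [← intervalIntegral.integral_const_mul]
  have h := intervalIntegral.integral_mono_on (μ := volume) zero_le_one
    (intervalIntegrable_const (c := ‖S.T 1 x‖ ^ 2))
    ((intervalIntegrable_norm_sq (S.continuous_rescaledOrbit z x) 0 1).const_mul (K ^ 2))
    (fun t ht => by
      have h1 : ‖Complex.exp (-z * t)‖ = 1 := by
        rw [Complex.norm_exp]; simp [hz]
      have h2 := (S.T (1 - t)).le_of_opNorm_le
        (hK (1 - t) ⟨by linarith [ht.2], by linarith [ht.1]⟩) (S.T t x)
      rw [← S.T_add_apply (by linarith [ht.2]) ht.1, sub_add_cancel] at h2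
      rw [S.rescaledOrbit_of_nonneg _ _ ht.1, norm_smul, h1, one_mul, ← mul_pow]
      gcongr)
  simpa using h

/-- The coefficients of the orbit of $x$ are $c_k=R(z+2\pi ik)y$, but bounded resolvents alone do
not make them square summable. After damping by $e^{-wt}$, $y=v-e^{-(w+z)}T(1)v$ is solvable with
$\|v\|\le2\|y\|$, and the coefficients $d_k$ of the damped orbit of $v$ are square summable by
Bessel. The resolvent identity gives $c_k=d_k+wR(z+2\pi ik)d_k$, so the bound passes to $c_k$, then
by Plancherel to the orbit of $x$ and to $T(1)x$. -/
theorem IsGeneratorOf.norm_le_of_resolvent (hA : IsGeneratorOf A S) {K M w : ℝ} (hK1 : 1 ≤ K)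
    (hK : ∀ t ∈ Icc (0 : ℝ) 1, ‖S.T t‖ ≤ K) (hM : 0 ≤ M) (hw : 0 ≤ w)
    (hwK : Real.exp (-w) * K ≤ 1 / 2) {z : ℂ} (hz : z.re = 0)
    (hR : ∀ k : ℤ, ∃ R, IsResolventAt A (z + 2 * Real.pi * k * Complex.I) R ∧ ‖R‖ ≤ M) (x : H) :
    ‖x‖ ≤ (1 + 2 * K ^ 2 * (1 + w * M)) * ‖x - Complex.exp (-z) • S.T 1 x‖ := by
  set y := x - Complex.exp (-z) • S.T 1 x with hy
  have hN : ‖Complex.exp (-(w + z)) • S.T 1‖ ≤ 1 / 2 := by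
    rw [norm_smul, Complex.norm_exp]
    refine le_trans ?_ hwK
    have : (-(w + z) : ℂ).re = -w := by simp [hz]
    rw [this]
    gcongr
    exact hK 1 ⟨zero_le_one, le_rfl⟩
  obtain ⟨v, hv, hvy⟩ := exists_sub_apply_eq hN y
  have hcoeff : ∀ k : ℤ, ‖unitFourierCoeff (S.rescaledOrbit z x) k‖ ≤
      (1 + w * M) * ‖unitFourierCoeff (S.rescaledOrbit (w + z) v) k‖ := by
    intro k
    obtain ⟨R, hR, hRM⟩ := hR k
    rw [S.unitFourierCoeff_rescaledOrbit, S.unitFourierCoeff_rescaledOrbit]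
    obtain ⟨hc, ec⟩ := hA.integral_rescaledOrbit (z + 2 * Real.pi * k * Complex.I) x zero_le_one
    rw [exp_neg_add_two_pi_mul, ← hy] at ec
    obtain ⟨hd, ed⟩ :=
      hA.integral_rescaledOrbit (w + z + 2 * Real.pi * k * Complex.I) v zero_le_one
    have h2 : v - Complex.exp (-(w + z)) • S.T 1 v = y := hv
    rw [exp_neg_add_two_pi_mul, h2] at ed
    have e1 := hR.2 ⟨_, hc⟩
    dsimp only at e1
    rw [ec, hR.apply_of_shift (add_assoc _ _ _) hd ed] at e1
    rw [← e1]
    set d := ∫ t in (0 : ℝ)..1, S.rescaledOrbit (w + z + 2 * Real.pi * k * Complex.I) v t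
    calc ‖d + (w : ℂ) • R d‖ ≤ ‖d‖ + ‖(w : ℂ) • R d‖ := norm_add_le _ _
      _ ≤ ‖d‖ + w * (M * ‖d‖) := by
        rw [norm_smul, Complex.norm_real, Real.norm_of_nonneg hw]
        gcongr
        exact R.le_of_opNorm_le hRM d
      _ = _ := by ring
  have hsum : ∫ t in (0 : ℝ)..1, ‖S.rescaledOrbit z x t‖ ^ 2 ≤ ((1 + w * M) * (K * ‖v‖)) ^ 2 := by
    refine integral_norm_sq_le_of_sum_sq_unitFourierCoeff_le (S.continuous_rescaledOrbit z x)
      fun s => ?_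
    calc ∑ k ∈ s, ‖unitFourierCoeff (S.rescaledOrbit z x) k‖ ^ 2
        ≤ ∑ k ∈ s, (1 + w * M) ^ 2 * ‖unitFourierCoeff (S.rescaledOrbit (w + z) v) k‖ ^ 2 := by
          refine Finset.sum_le_sum fun k _ => ?_
          rw [← mul_pow]
          gcongr
          exact hcoeff k
      _ = (1 + w * M) ^ 2 * ∑ k ∈ s, ‖unitFourierCoeff (S.rescaledOrbit (w + z) v) k‖ ^ 2 :=
          (Finset.mul_sum _ _ _).symm
      _ ≤ (1 + w * M) ^ 2 * (K * ‖v‖) ^ 2 := by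
          gcongr
          refine (sum_sq_unitFourierCoeff_le (S.continuous_rescaledOrbit _ v) s).trans ?_
          exact S.integral_norm_sq_rescaledOrbit_le hK (by simp [hz, hw]) v
      _ = _ := (mul_pow _ _ _).symm
  have hT : ‖S.T 1 x‖ ≤ K * ((1 + w * M) * (K * ‖v‖)) := by
    refine le_of_sq_le_sq ?_ (by positivity)
    rw [mul_pow]
    refine (S.norm_sq_T_one_le hK hz x).trans ?_
    gcongr
  have hx : ‖x‖ ≤ ‖y‖ + ‖S.T 1 x‖ := by
    have h1 : ‖Complex.exp (-z) • S.T 1 x‖ = ‖S.T 1 x‖ := by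
      rw [norm_smul, Complex.norm_exp]; simp [hz]
    calc ‖x‖ = ‖y + Complex.exp (-z) • S.T 1 x‖ := by rw [hy, sub_add_cancel]
      _ ≤ _ := norm_add_le _ _
      _ = _ := by rw [h1]
  calc ‖x‖ ≤ ‖y‖ + K * ((1 + w * M) * (K * (2 * ‖y‖))) := by
        refine hx.trans ?_
        gcongr
        refine hT.trans ?_
        gcongr
    _ = _ := by ring

/-- The $k$-th coefficient of $t\mapsto e^{-zt}T(t)x$ equals $u-e^{-z}T(1)u$ with $u=R(z+2\pi ik)x$,
hence is orthogonal to $\varphi$. So $\langle\varphi,e^{-zt}T(t)x\rangle$ vanishes on $[0,1]$;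
evaluate at $t=0$. -/
theorem IsGeneratorOf.eq_zero_of_inner_eq_zero (hA : IsGeneratorOf A S) {z : ℂ} (hz : z.re = 0)
    (hR : ∀ k : ℤ, ∃ R, IsResolventAt A (z + 2 * Real.pi * k * Complex.I) R) {φ : H}
    (hφ : ∀ x, inner ℂ φ (x - Complex.exp (-z) • S.T 1 x) = 0) : φ = 0 := by
  obtain ⟨K, -, hK⟩ := S.exists_norm_le 1
  have key : ∀ x, inner ℂ φ x = 0 := by
    intro x
    have hc := S.continuous_rescaledOrbit z x
    have hcg : Continuous fun t => inner ℂ φ (S.rescaledOrbit z x t) := by fun_prop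
    have h0 : ∀ k, unitFourierCoeff (fun t => inner ℂ φ (S.rescaledOrbit z x t)) k = 0 := by
      intro k
      obtain ⟨R, hR⟩ := hR k
      rw [← inner_unitFourierCoeff hc, S.unitFourierCoeff_rescaledOrbit]
      obtain ⟨V, -, hV⟩ := S.exists_truncatedLaplace zero_le_one hK
        (z := z + 2 * Real.pi * k * Complex.I) (by simp [hz])
      obtain ⟨hu, eu⟩ := hR.1 x
      have h1 := hA.truncatedLaplace_apply zero_le_one hV ⟨R x, hu⟩
      rw [exp_neg_add_two_pi_mul] at h1
      simp only [eu] at h1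
      rw [← hV, h1]
      exact hφ _
    have hs := hasSum_sq_unitFourierCoeff hcg
    simp only [h0, norm_zero, ne_eq, OfNat.ofNat_ne_zero, not_false_eq_true, zero_pow] at hs
    have hI := hs.unique hasSum_zero
    rw [intervalIntegral.integral_of_le zero_le_one, ← integral_Icc_eq_integral_Ioc,
      integral_eq_zero_iff_of_nonneg (fun t => sq_nonneg _)
        (Continuous.integrableOn_Icc (hcg.norm.pow 2))] at hI
    have h2 := Measure.eqOn_Icc_of_ae_eq volume zero_ne_one hI (hcg.norm.pow 2).continuousOn
      continuousOn_const (left_mem_Icc.2 zero_le_one)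
    simpa [S.rescaledOrbit_of_nonneg, S.T_zero_apply] using h2
  simpa using key φ

/-- If the resolvent of the generator exists and is bounded on the imaginary axis, then the unit
circle belongs to the resolvent set of `T(1)`. -/
theorem IsGeneratorOf.isUnit_one_sub (hA : IsGeneratorOf A S) {M : ℝ}
    (hR : ∀ ω : ℝ, ∃ R, IsResolventAt A (Complex.I * ω) R ∧ ‖R‖ ≤ M) (θ : ℝ) :
    IsUnit (1 - Complex.exp (-(Complex.I * θ)) • S.T 1) := by
  obtain ⟨K, hK1, hK⟩ := S.exists_norm_le 1
  have hM : 0 ≤ M := by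
    obtain ⟨R, -, h⟩ := hR 0
    exact (norm_nonneg R).trans h
  have hR' : ∀ k : ℤ, ∃ R,
      IsResolventAt A (Complex.I * θ + 2 * Real.pi * k * Complex.I) R ∧ ‖R‖ ≤ M := by
    intro k
    obtain ⟨R, h1, h2⟩ := hR (θ + 2 * Real.pi * k)
    refine ⟨R, ?_, h2⟩
    convert h1 using 1
    push_cast
    ring
  -- The damping rate $w=\log(2K)$ gives $e^{-w}K=1/2$.
  have hw : 0 ≤ Real.log (2 * K) := Real.log_nonneg (by linarith)
  have hwK : Real.exp (-Real.log (2 * K)) * K ≤ 1 / 2 := by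
    rw [Real.exp_neg, Real.exp_log (by linarith)]
    apply le_of_eq
    field_simp
  have hre : (Complex.I * θ).re = 0 := by simp
  obtain ⟨W, h1, h2, -⟩ := exists_inverse_of_bounded_below
    (1 - Complex.exp (-(Complex.I * θ)) • S.T 1)
    (C := 1 + 2 * K ^ 2 * (1 + Real.log (2 * K) * M)) (by positivity)
    (hA.norm_le_of_resolvent hK1 hK hM hw hwK hre hR')
    (fun φ hφ => hA.eq_zero_of_inner_eq_zero hre (fun k => (hR' k).imp fun _ h => h.1) hφ)
  exact ⟨⟨_, W, h2, h1⟩, rfl⟩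

end UnitCircle

/-! ### Spectral splitting for an operator whose spectrum misses the unit circle. -/

section Dichotomy

variable {E : Type*} [NormedAddCommGroup E] [NormedSpace ℂ E] [CompleteSpace E]

/-- The Green's function `G_n = ∫₀¹ e^{2πinv} N(v) dv`. -/
noncomputable def greenCoeff {F : Type*} [NormedAddCommGroup F] [NormedSpace ℂ F]
    (N : ℝ → F) (n : ℤ) : F :=
  ∫ v in (0 : ℝ)..1, Complex.exp (2 * Real.pi * n * v * Complex.I) • N v

theorem tendsto_greenCoeff {F : Type*} [NormedAddCommGroup F] [NormedSpace ℂ F] (N : ℝ → F) :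
    Tendsto (greenCoeff N) cofinite (𝓝 0) := by
  have h := Real.tendsto_integral_exp_smul_cocompact (indicator (Ioc (0 : ℝ) 1) N)
  -- The Riemann–Lebesgue lemma is stated for $e^{-2\pi ivw}$, hence the evaluation at $w=-n$.
  have h2 : Tendsto (fun n : ℤ => -(n : ℝ)) cofinite (cocompact ℝ) :=
    ((Homeomorph.neg ℝ).isClosedEmbedding.tendsto_cocompact).comp Int.tendsto_coe_cofinite
  refine (h.comp h2).congr fun n => ?_
  rw [greenCoeff, intervalIntegral.integral_of_le zero_le_one, ← integral_indicator measurableSet_Ioc,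
    Function.comp_apply]
  congr 1
  funext v
  rw [mul_neg, neg_neg, Circle.smul_def, Real.fourierChar_apply]
  by_cases hv : v ∈ Ioc (0 : ℝ) 1
  · rw [indicator_of_mem hv, indicator_of_mem hv]
    congr 2
    push_cast
    ring
  · rw [indicator_of_notMem hv, indicator_of_notMem hv, smul_zero]

theorem integral_exp_two_pi_mul {n : ℤ} (hn : n ≠ 0) :
    ∫ v in (0 : ℝ)..1, Complex.exp (2 * Real.pi * n * v * Complex.I) = 0 := by
  have hc : (2 * Real.pi * n * Complex.I : ℂ) ≠ 0 := by
    simp [Real.pi_ne_zero, hn]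
  have h := integral_exp_mul_complex (a := 0) (b := 1) hc
  have h2 : Complex.exp (2 * Real.pi * n * Complex.I) = 1 := by
    rw [← Complex.exp_int_mul_two_pi_mul_I n]
    congr 1
    ring
  simp only [Complex.ofReal_one, mul_one, h2, Complex.ofReal_zero, mul_zero, Complex.exp_zero,
    sub_self, zero_div] at h
  rw [← h]
  congr 1
  funext v
  congr 1
  ring

/-- Integrate $e^{2\pi inv}(N(v)-e^{-2\pi iv}TN(v))=e^{2\pi inv}$ over a period. -/
theorem greenCoeff_sub {T : E →L[ℂ] E} {N : ℝ → E →L[ℂ] E} (hN : Continuous N)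
    (h : ∀ v : ℝ, (1 - Complex.exp (-(2 * Real.pi * v * Complex.I)) • T) * N v = 1) (n : ℤ) :
    greenCoeff N n - T * greenCoeff N (n - 1) = if n = 0 then 1 else 0 := by
  have e : T * greenCoeff N (n - 1) = ∫ v in (0 : ℝ)..1,
      T * (Complex.exp (2 * Real.pi * (n - 1 : ℤ) * v * Complex.I) • N v) := by
    have := (ContinuousLinearMap.mul ℂ (E →L[ℂ] E) T).intervalIntegral_comp_comm
      (f := fun v : ℝ => Complex.exp (2 * Real.pi * (n - 1 : ℤ) * v * Complex.I) • N v)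
      (μ := volume) (a := 0) (b := 1) (Continuous.intervalIntegrable (by fun_prop) _ _)
    exact this.symm
  rw [e, greenCoeff, ← intervalIntegral.integral_sub
    (Continuous.intervalIntegrable (by fun_prop) _ _)
    (Continuous.intervalIntegrable (by fun_prop) _ _)]
  have e2 : ∀ v : ℝ, Complex.exp (2 * Real.pi * n * v * Complex.I) • N v -
      T * (Complex.exp (2 * Real.pi * (n - 1 : ℤ) * v * Complex.I) • N v) =
      Complex.exp (2 * Real.pi * n * v * Complex.I) • (1 : E →L[ℂ] E) := by
    intro v
    rw [← h v, sub_mul, one_mul, smul_sub, smul_mul_assoc, smul_smul, ← Complex.exp_add,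
      mul_smul_comm]
    congr 3
    push_cast
    ring
  simp_rw [e2]
  rw [intervalIntegral.integral_smul_const]
  split_ifs with hn
  · simp [hn]
  · rw [integral_exp_two_pi_mul hn, zero_smul]

theorem commute_greenCoeff {U : E →L[ℂ] E} {N : ℝ → E →L[ℂ] E} (hN : Continuous N)
    (h : ∀ v, Commute U (N v)) (n : ℤ) : Commute U (greenCoeff N n) := by
  have hI : IntervalIntegrable
      (fun v : ℝ => Complex.exp (2 * Real.pi * n * v * Complex.I) • N v) volume 0 1 :=
    Continuous.intervalIntegrable (by fun_prop) _ _
  have e1 := (ContinuousLinearMap.mul ℂ (E →L[ℂ] E) U).intervalIntegral_comp_comm hI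
  have e2 := ((ContinuousLinearMap.mul ℂ (E →L[ℂ] E)).flip U).intervalIntegral_comp_comm hI
  change U * greenCoeff N n = greenCoeff N n * U
  refine e1.symm.trans (Eq.trans ?_ e2)
  congr 1
  funext v
  change U * _ = _ * U
  rw [mul_smul_comm, smul_mul_assoc, (h v).eq]

/-- If the unit circle belongs to the resolvent set of `T`, there is a projection `P` commuting with
everything that commutes with `T`, such that a power of `T` contracts the range of `P` and is
inverted by a contraction on the kernel of `P`. -/
theorem exists_dichotomy {T : E →L[ℂ] E}
    (h : ∀ v : ℝ, IsUnit (1 - Complex.exp (-(2 * Real.pi * v * Complex.I)) • T)) :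
    ∃ (P L : E →L[ℂ] E) (n : ℕ), 0 < n ∧ P * P = P ∧ (∀ U, Commute U T → Commute U P) ∧
      (∀ U, Commute U T → Commute U L) ∧ ‖T ^ n * P‖ ≤ 1 / 2 ∧ ‖L‖ ≤ 1 / 2 ∧
      T ^ n * L = 1 - P := by
  choose u hu using h
  let N : ℝ → E →L[ℂ] E := fun v => (↑(u v)⁻¹ : E →L[ℂ] E)
  have hNc : Continuous N := by
    have e : N = fun v : ℝ =>
        Ring.inverse (1 - Complex.exp (-(2 * Real.pi * v * Complex.I)) • T) := by
      funext v
      rw [← hu v, Ring.inverse_unit]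
    rw [e, continuous_iff_continuousAt]
    intro v
    have h1 := NormedRing.inverse_continuousAt (u v)
    rw [hu v] at h1
    refine ContinuousAt.comp (g := Ring.inverse) h1 (Continuous.continuousAt ?_)
    fun_prop
  have hN1 : ∀ v : ℝ, (1 - Complex.exp (-(2 * Real.pi * v * Complex.I)) • T) * N v = 1 := by
    intro v
    rw [← hu v]
    exact (u v).mul_inv
  have hcomm : ∀ U, Commute U T → ∀ n, Commute U (greenCoeff N n) := by
    intro U hU n
    refine commute_greenCoeff hNc (fun v => ?_) n
    apply Commute.units_inv_right
    rw [hu v]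
    exact (Commute.one_right U).sub_right (hU.smul_right _)
  have hrec := greenCoeff_sub hNc hN1
  set G := greenCoeff N with hG
  have hlim := tendsto_greenCoeff N
  have hpos : Tendsto (fun n : ℕ => G n) atTop (𝓝 0) := by
    rw [← Nat.cofinite_eq_atTop]
    exact hlim.comp (Nat.cast_injective (R := ℤ)).tendsto_cofinite
  have hneg : Tendsto (fun n : ℕ => G (-n)) atTop (𝓝 0) := by
    rw [← Nat.cofinite_eq_atTop]
    exact hlim.comp (neg_injective.comp (Nat.cast_injective (R := ℤ))).tendsto_cofinite
  have hstep : ∀ n : ℤ, n ≠ 0 → G n = T * G (n - 1) := by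
    intro n hn
    have := hrec n
    rwa [if_neg hn, sub_eq_zero] at this
  have hGpos : ∀ n : ℕ, T ^ n * G 0 = G n := by
    intro n
    induction n with
    | zero => simp
    | succ n ih =>
      rw [hstep (n + 1 : ℕ) (by exact_mod_cast n.succ_ne_zero), pow_succ', mul_assoc, ih]
      congr 2
      push_cast
      ring
  have hGneg : ∀ n : ℕ, T ^ (n + 1) * G (-(n + 1 : ℕ)) = G 0 - 1 := by
    intro n
    induction n with
    | zero =>
      have := hrec 0
      rw [if_pos rfl] at this
      rw [← this]
      simp
    | succ n ih =>
      rw [← ih, pow_succ, mul_assoc, hstep (-(n + 1 : ℕ)) (by push_cast; omega)]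
      congr 3
  -- For every $n\ge1$, $G_0(G_0-1)=G_0T^nG_{-n}=G_nG_{-n}$, and this tends to $0$.
  have hPP : G 0 * (G 0 - 1) = 0 := by
    have h1 : ∀ n : ℕ, G (n + 1 : ℕ) * G (-(n + 1 : ℕ)) = G 0 * (G 0 - 1) := by
      intro n
      rw [← hGneg n, ← hGpos, ← mul_assoc]
      congr 1
      exact ((hcomm T (Commute.refl T) 0).pow_left (n + 1)).eq
    have h2 : Tendsto (fun n : ℕ => G (n + 1 : ℕ) * G (-(n + 1 : ℕ))) atTop (𝓝 (0 * 0)) :=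
      (hpos.comp (tendsto_add_atTop_nat 1)).mul (hneg.comp (tendsto_add_atTop_nat 1))
    simp_rw [h1] at h2
    rw [mul_zero] at h2
    exact tendsto_nhds_unique tendsto_const_nhds h2
  have hn : ∀ᶠ n : ℕ in atTop, ‖G n‖ < 1 / 2 ∧ ‖G (-n)‖ < 1 / 2 ∧ 0 < n := by
    have h1 := hpos.norm
    have h2 := hneg.norm
    rw [norm_zero] at h1 h2
    filter_upwards [h1.eventually_lt_const (by norm_num : (0 : ℝ) < 1 / 2),
      h2.eventually_lt_const (by norm_num : (0 : ℝ) < 1 / 2), eventually_gt_atTop 0] with n a b c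
    exact ⟨a, b, c⟩
  obtain ⟨n, hn1, hn2, hn0⟩ := hn.exists
  -- $P=G_0$ is the stable projection: $T^nG_0=G_n$ is small. Since $T^nG_{-n}=G_0-1$, the small
  -- operator $-G_{-n}$ inverts $T^n$ on $\ker P$.
  refine ⟨G 0, -G (-n), n, hn0, ?_, fun U hU => hcomm U hU 0, fun U hU => (hcomm U hU _).neg_right,
    ?_, ?_, ?_⟩
  · rwa [mul_sub, mul_one, sub_eq_zero] at hPP
  · rw [hGpos]; exact hn1.le
  · rw [norm_neg]; exact hn2.le
  · obtain ⟨m, rfl⟩ := Nat.exists_eq_succ_of_ne_zero hn0.ne'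
    rw [mul_neg, hGneg m, neg_sub]

end Dichotomy

/-! ### From the discrete dichotomy to hyperbolicity of the semigroup. -/

section Gearhart

/-- Iterating a contraction estimate over time steps of length `τ` gives exponential decay. -/
theorem half_pow_floor_le (τ t : ℝ) :
    (1 / 2 : ℝ) ^ ⌊t / τ⌋₊ ≤ 2 * Real.exp (-(Real.log 2 / τ) * t) := by
  have h1 : t / τ < ⌊t / τ⌋₊ + 1 := Nat.lt_floor_add_one _
  have h2 : (1 / 2 : ℝ) ^ ⌊t / τ⌋₊ = 2 * Real.exp (-Real.log 2 * (⌊t / τ⌋₊ + 1)) := by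
    rw [mul_add_one, Real.exp_add, mul_comm (-Real.log 2), Real.exp_nat_mul, Real.exp_neg,
      Real.exp_log two_pos]
    ring
  rw [h2]
  refine mul_le_mul_of_nonneg_left (Real.exp_le_exp.2 ?_) zero_le_two
  rw [neg_mul, neg_mul, neg_le_neg_iff, div_mul_eq_mul_div, mul_div_assoc]
  have := Real.log_nonneg one_le_two
  gcongr

variable {E : Type*} [NormedAddCommGroup E] [NormedSpace ℂ E] [CompleteSpace E]

/-- The stable space is $\operatorname{ran}P=\ker(1-P)$ and the unstable one is $\ker P$, where $L$
inverts $T(n)$. All operators commute, so both spaces are invariant and the estimates iterate over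
multiples of $n$; intermediate times cost the bound $K$ of $T$ on $[0,n]$. Bijectivity of $T(t)$ on
$\ker P$ follows from that of $T(kn)$ with $kn\ge t$. -/
theorem C0Semigroup.isHyperbolic_of_dichotomy (S : C0Semigroup E) {P L : E →L[ℂ] E} {n : ℕ}
    (hn : 0 < n) (hP : P * P = P) (hTP : ∀ t, 0 ≤ t → Commute (S.T t) P)
    (hTL : ∀ t, 0 ≤ t → Commute (S.T t) L) (hPL : Commute P L) (hs : ‖S.T n * P‖ ≤ 1 / 2)
    (hL : ‖L‖ ≤ 1 / 2) (hTnL : S.T n * L = 1 - P) : S.IsHyperbolic := by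
  have hn' : (0 : ℝ) < n := by exact_mod_cast hn
  obtain ⟨K, hK1, hK⟩ := S.exists_norm_le n
  have hPT : ∀ t, 0 ≤ t → ∀ x, P (S.T t x) = S.T t (P x) := fun t ht x =>
    DFunLike.congr_fun (hTP t ht).eq.symm x
  have hLT : ∀ t, 0 ≤ t → ∀ x, L (S.T t x) = S.T t (L x) := fun t ht x =>
    DFunLike.congr_fun (hTL t ht).eq.symm x
  have hPP : ∀ x, P (P x) = P x := fun x => DFunLike.congr_fun hP x
  have hinv : ∀ x, P x = 0 → S.T n (L x) = x := by
    intro x hx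
    have := DFunLike.congr_fun hTnL x
    simpa [hx] using this
  have hker : ∀ x, P x = 0 → P (L x) = 0 := by
    intro x hx
    have : P (L x) = L (P x) := DFunLike.congr_fun hPL.eq x
    rw [this, hx, map_zero]
  have hmul : ∀ k : ℕ, (0 : ℝ) ≤ k * n := fun k => by positivity
  have hinvk : ∀ (k : ℕ) x, P x = 0 →
      S.T (k * n) ((L ^ k) x) = x ∧ P ((L ^ k) x) = 0 := by
    intro k
    induction k with
    | zero => intro x hx; simp [S.T_zero_apply, hx]
    | succ k ih =>
      intro x hx
      obtain ⟨h1, h2⟩ := ih x hx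
      rw [pow_succ', mul_apply_eq_comp]
      refine ⟨?_, hker _ h2⟩
      rw [Nat.cast_succ, add_one_mul, S.T_add_apply (hmul k) hn'.le, hinv _ h2, h1]
  have hLk : ∀ (k : ℕ) x, ‖(L ^ k) x‖ ≤ (1 / 2) ^ k * ‖x‖ := by
    intro k x
    induction k with
    | zero => simp
    | succ k ih =>
      rw [pow_succ', pow_succ', mul_apply_eq_comp, mul_assoc]
      exact (L.le_of_opNorm_le hL _).trans (by gcongr)
  have hcommLk : ∀ (k : ℕ) t, 0 ≤ t → ∀ x, (L ^ k) (S.T t x) = S.T t ((L ^ k) x) := fun k t ht x =>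
    DFunLike.congr_fun ((hTL t ht).pow_right k).eq.symm x
  have hstab : ∀ (k : ℕ) x, P x = x → ‖S.T (k * n) x‖ ≤ (1 / 2) ^ k * ‖x‖ := by
    intro k
    induction k with
    | zero => intro x _; simp [S.T_zero_apply]
    | succ k ih =>
      intro x hx
      rw [Nat.cast_succ, add_one_mul, S.T_add_apply (hmul k) hn'.le]
      refine (ih _ (by rw [hPT _ hn'.le, hx])).trans ?_
      have : ‖S.T n x‖ ≤ 1 / 2 * ‖x‖ := by
        have := (S.T n * P).le_of_opNorm_le hs x
        rwa [mul_apply_eq_comp, hx] at this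
      rw [pow_succ, mul_assoc]
      gcongr
  have hfloor : ∀ t : ℝ, 0 ≤ t → 0 ≤ t - ⌊t / n⌋₊ * n ∧ t - ⌊t / n⌋₊ * n ≤ n := by
    intro t ht
    have h1 := Nat.floor_le (div_nonneg ht hn'.le)
    have h2 := Nat.lt_floor_add_one (t / n)
    rw [le_div_iff₀ hn'] at h1
    rw [div_lt_iff₀ hn'] at h2
    constructor <;> linarith
  refine ⟨LinearMap.ker ((1 : E →L[ℂ] E) - P).toLinearMap, LinearMap.ker P.toLinearMap,
    ContinuousLinearMap.isClosed_ker (1 - P), ContinuousLinearMap.isClosed_ker P, ?_, ?_, ?_,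
    2 * K, Real.log 2 / n, div_pos (Real.log_pos one_lt_two) hn', ?_, ?_⟩
  · have hmem : ∀ x, x ∈ LinearMap.ker ((1 : E →L[ℂ] E) - P).toLinearMap ↔ P x = x := by
      intro x
      rw [LinearMap.mem_ker]
      change x - P x = 0 ↔ _
      rw [sub_eq_zero, eq_comm]
    constructor
    · rw [Submodule.disjoint_def]
      intro x h1 h2
      rw [← (hmem x).1 h1]
      exact h2
    · rw [codisjoint_iff, Submodule.eq_top_iff']
      intro x
      refine Submodule.mem_sup.2 ⟨P x, (hmem _).2 (hPP x), x - P x, ?_, by abel⟩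
      change P (x - P x) = 0
      rw [map_sub, hPP, sub_self]
  · intro t ht x hx
    change S.T t x - P (S.T t x) = 0
    have hx' : x - P x = 0 := hx
    rw [hPT t ht, ← map_sub, hx', map_zero]
  · intro t ht
    have hinj : ∀ x, P x = 0 → S.T t x = 0 → x = 0 := by
      intro x hx h0
      obtain ⟨k, hk⟩ := exists_nat_ge (t / n)
      rw [div_le_iff₀ hn'] at hk
      have h1 := (hinvk k x hx).1
      rw [← hcommLk k _ (hmul k), ← sub_add_cancel (k * n : ℝ) t,
        S.T_add_apply (sub_nonneg.2 hk) ht, h0, map_zero, map_zero] at h1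
      exact h1.symm
    refine ⟨fun x hx => ?_, fun x hx y hy hxy => ?_, fun y hy => ?_⟩
    · change P (S.T t x) = 0
      have hx' : P x = 0 := hx
      rw [hPT t ht, hx', map_zero]
    · rw [← sub_eq_zero]
      have hx' : P x = 0 := hx
      have hy' : P y = 0 := hy
      refine hinj _ (by rw [map_sub, hx', hy', sub_zero]) ?_
      rw [map_sub, hxy, sub_self]
    · obtain ⟨k, hk⟩ := exists_nat_ge (t / n)
      rw [div_le_iff₀ hn'] at hk
      obtain ⟨h1, h2⟩ := hinvk k y hy
      refine ⟨S.T (k * n - t) ((L ^ k) y), ?_, ?_⟩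
      · change P _ = 0
        rw [hPT _ (sub_nonneg.2 hk), h2, map_zero]
      · rw [← S.T_add_apply ht (sub_nonneg.2 hk), add_sub_cancel, h1]
  · intro t ht x hx
    have hx' : P x = x := (sub_eq_zero.1 (show x - P x = 0 from hx)).symm
    obtain ⟨h0, h1⟩ := hfloor t ht
    have e : S.T t x = S.T (t - ⌊t / n⌋₊ * n) (S.T (⌊t / n⌋₊ * n) x) := by
      rw [← S.T_add_apply h0 (hmul _), sub_add_cancel]
    rw [e]
    calc _ ≤ K * ((1 / 2) ^ ⌊t / n⌋₊ * ‖x‖) :=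
          ((S.T _).le_of_opNorm_le (hK _ ⟨h0, h1⟩) _).trans (by gcongr; exact hstab _ x hx')
      _ ≤ K * (2 * Real.exp (-(Real.log 2 / n) * t) * ‖x‖) := by
          gcongr
          exact half_pow_floor_le n t
      _ = _ := by ring
  · intro t ht x hx
    have hx' : P x = 0 := hx
    obtain ⟨h0, h1⟩ := hfloor t ht
    -- On the unstable part $t$ is rounded up to a multiple of $n$: a lower bound for $T(t)x$
    -- follows from one at a later time.
    have e : S.T (n - (t - ⌊t / n⌋₊ * n)) (S.T t x) = S.T ((⌊t / n⌋₊ + 1 : ℕ) * n) x := by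
      rw [← S.T_add_apply (by linarith) ht]
      congr 2
      push_cast
      ring
    have h2 : ‖x‖ ≤ (1 / 2) ^ (⌊t / n⌋₊ + 1) * ‖S.T ((⌊t / n⌋₊ + 1 : ℕ) * n) x‖ := by
      have h3 := (hinvk (⌊t / n⌋₊ + 1) x hx').1
      rw [← hcommLk _ _ (hmul _)] at h3
      calc ‖x‖ = _ := by rw [h3]
        _ ≤ _ := hLk _ _
    rw [← e] at h2
    refine h2.trans ?_
    have h3 := (S.T (n - (t - ⌊t / n⌋₊ * n))).le_of_opNorm_le
      (hK _ ⟨by linarith, by linarith⟩) (S.T t x)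
    have h4 : (1 / 2 : ℝ) ^ (⌊t / n⌋₊ + 1) ≤ 2 * Real.exp (-(Real.log 2 / n) * t) := by
      refine le_trans ?_ (half_pow_floor_le n t)
      exact pow_le_pow_of_le_one (by norm_num) (by norm_num) (Nat.le_succ _)
    calc _ ≤ (2 * Real.exp (-(Real.log 2 / n) * t)) * (K * ‖S.T t x‖) := by gcongr
      _ = _ := by ring

/-- The Gearhart–Prüss theorem for hyperbolic semigroups on Hilbert spaces. -/
theorem IsGeneratorOf.isHyperbolic {H : Type*} [NormedAddCommGroup H] [InnerProductSpace ℂ H]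
    [CompleteSpace H] {A : H →ₗ.[ℂ] H} {S : C0Semigroup H} (hA : IsGeneratorOf A S) {M : ℝ}
    (hR : ∀ ω : ℝ, ∃ R, IsResolventAt A (Complex.I * ω) R ∧ ‖R‖ ≤ M) : S.IsHyperbolic := by
  obtain ⟨P, L, n, hn, hP, hTP, hTL, hs, hL, hTn⟩ := exists_dichotomy (T := S.T 1) (fun v => by
    have := hA.isUnit_one_sub hR (2 * Real.pi * v)
    rwa [show Complex.I * (2 * Real.pi * v : ℝ) = 2 * Real.pi * v * Complex.I by
      push_cast; ring] at this)
  have hpow : S.T n = S.T 1 ^ n := by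
    rw [← S.T_nat_mul zero_le_one, mul_one]
  have hcomm : ∀ t, 0 ≤ t → Commute (S.T t) (S.T 1) := fun t ht => S.commute ht zero_le_one
  refine S.isHyperbolic_of_dichotomy hn hP (fun t ht => hTP _ (hcomm t ht))
    (fun t ht => hTL _ (hcomm t ht)) (hTL _ (hTP _ (Commute.refl _)).symm) ?_ hL ?_
  · rwa [hpow]
  · rwa [hpow]

end Gearhart

/-! ### Bounded resolvents on $i\mathbb R$ for hyperbolic semigroups. -/

section HyperbolicResolvent

theorem exists_continuous_projection {E : Type*} [NormedAddCommGroup E] [NormedSpace ℂ E]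
    [CompleteSpace E] {p q : Submodule ℂ E} (h : IsCompl p q) (hp : IsClosed (p : Set E))
    (hq : IsClosed (q : Set E)) : ∃ P : E →L[ℂ] E, (∀ x, P x ∈ p) ∧ (∀ x, x - P x ∈ q) ∧
      (∀ x ∈ p, P x = x) ∧ ∀ x ∈ q, P x = 0 := by
  have ht : Submodule.IsTopCompl p q := Submodule.isTopCompl_iff_isCompl_isClosed.2 ⟨h, hp, hq⟩
  have h1 : ∀ x, p.projectionL q ht x ∈ p := Submodule.projectionL_apply_mem ht
  have h2 : ∀ x ∈ p, p.projectionL q ht x = x := fun x hx =>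
    Submodule.projectionL_apply_left ht ⟨x, hx⟩
  refine ⟨p.projectionL q ht, h1, fun x => ?_, h2, fun x hx => ?_⟩
  · have h3 : p.projectionL q ht (x - p.projectionL q ht x) = 0 := by
      rw [map_sub, h2 _ (h1 x), sub_self]
    rw [Submodule.projectionL_apply] at h3
    exact (Submodule.projectionOntoL_apply_eq_zero_iff ht).1 (Subtype.ext h3)
  · rw [Submodule.projectionL_apply, (Submodule.projectionOntoL_apply_eq_zero_iff ht).2 hx]
    rfl

/-- Iterating replaces $x$ by vectors of norm at most $2^{-k}\|x\|$ without changing the inner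
product with $\varphi$. -/
theorem inner_eq_zero_of_contraction {H : Type*} [NormedAddCommGroup H] [InnerProductSpace ℂ H]
    {φ : H} {F : Set H}
    (hF : ∀ x ∈ F, ∃ x' ∈ F, inner ℂ φ x = inner ℂ φ x' ∧ ‖x'‖ ≤ 1 / 2 * ‖x‖) {x : H}
    (hx : x ∈ F) : inner ℂ φ x = 0 := by
  have key : ∀ (k : ℕ), ∀ x ∈ F, ‖inner ℂ φ x‖ ≤ ‖φ‖ * ((1 / 2) ^ k * ‖x‖) := by
    intro k
    induction k with
    | zero => intro x _; simpa using norm_inner_le_norm φ x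
    | succ k ih =>
      intro x hx
      obtain ⟨x', hx', h1, h2⟩ := hF x hx
      rw [h1, pow_succ, mul_assoc]
      exact (ih x' hx').trans (by gcongr)
  have hlim : Tendsto (fun k : ℕ => ‖φ‖ * ((1 / 2 : ℝ) ^ k * ‖x‖)) atTop (𝓝 0) := by
    have := ((tendsto_pow_atTop_nhds_zero_of_lt_one (r := (1 / 2 : ℝ)) (by norm_num)
      (by norm_num)).mul_const ‖x‖).const_mul ‖φ‖
    simpa using this
  exact norm_le_zero_iff.1 (ge_of_tendsto' hlim fun k => key k x hx)

variable {H : Type*} [NormedAddCommGroup H] [InnerProductSpace ℂ H] [CompleteSpace H]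

/-- For a hyperbolic semigroup some `T(b)` has uniformly bounded resolvent on the unit circle. -/
theorem C0Semigroup.IsHyperbolic.exists_inverse {S : C0Semigroup H} (hS : S.IsHyperbolic) :
    ∃ b C : ℝ, 0 ≤ b ∧ 0 ≤ C ∧ ∀ c : ℂ, ‖c‖ = 1 → ∃ W : H →L[ℂ] H,
      W * (1 - c • S.T b) = 1 ∧ (1 - c • S.T b) * W = 1 ∧ ‖W‖ ≤ C := by
  obtain ⟨Es, Eu, hEs, hEu, hcompl, hms, hbu, M, ε, hε, hs, hu⟩ := hS
  obtain ⟨P, hP1, hP2, hP3, hP4⟩ := exists_continuous_projection hcompl hEs hEu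
  obtain ⟨b, hb0, hb⟩ : ∃ b : ℝ, 0 ≤ b ∧ M * Real.exp (-ε * b) ≤ 1 / 2 := by
    have h1 : Tendsto (fun b : ℝ => M * Real.exp (-ε * b)) atTop (𝓝 (M * 0)) := by
      refine Tendsto.const_mul _ (Real.tendsto_exp_atBot.comp ?_)
      exact tendsto_id.const_mul_atTop_of_neg (neg_lt_zero.2 hε)
    rw [mul_zero] at h1
    have h2 := h1.eventually_le_const (by norm_num : (0 : ℝ) < 1 / 2)
    obtain ⟨b, h3, h4⟩ := (h2.and (eventually_ge_atTop 0)).exists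
    exact ⟨b, h4, h3⟩
  have hs' : ∀ x ∈ Es, ‖S.T b x‖ ≤ 1 / 2 * ‖x‖ := fun x hx =>
    (hs b hb0 x hx).trans (by gcongr)
  have hu' : ∀ x ∈ Eu, ‖x‖ ≤ 1 / 2 * ‖S.T b x‖ := fun x hx =>
    (hu b hb0 x hx).trans (by gcongr)
  refine ⟨b, 1 + 3 * ‖P‖, hb0, by positivity, fun c hc => ?_⟩
  have hc0 : c ≠ 0 := by
    rintro rfl
    simp at hc
  have happ : ∀ x, (1 - c • S.T b) x = x - c • S.T b x := fun x => rfl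
  have hnorm : ∀ x, ‖c • S.T b x‖ = ‖S.T b x‖ := fun x => by rw [norm_smul, hc, one_mul]
  have hNs : ∀ x ∈ Es, c • S.T b x ∈ Es := fun x hx => Es.smul_mem c (hms b hb0 hx)
  have hNu : ∀ x ∈ Eu, c • S.T b x ∈ Eu := fun x hx => Eu.smul_mem c ((hbu b hb0).mapsTo hx)
  refine exists_inverse_of_bounded_below _ (by positivity) (fun x => ?_) (fun φ hφ => ?_)
  · rw [happ]
    set y := x - c • S.T b x with hy
    have hx : x = P x + (x - P x) := by abel
    have e1 : P y = P x - c • S.T b (P x) := by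
      have h1 : y = (P x - c • S.T b (P x)) + ((x - P x) - c • S.T b (x - P x)) := by
        rw [hy, map_sub, smul_sub]
        abel
      rw [h1, map_add, hP3 _ (Es.sub_mem (hP1 x) (hNs _ (hP1 x))),
        hP4 _ (Eu.sub_mem (hP2 x) (hNu _ (hP2 x))), add_zero]
    have e2 : y - P y = (x - P x) - c • S.T b (x - P x) := by
      rw [e1, hy, map_sub, smul_sub]
      abel
    have h1 : ‖P x‖ ≤ ‖P y‖ + ‖S.T b (P x)‖ := by
      rw [← hnorm, e1]
      exact norm_le_norm_sub_add _ _
    have h2 := hs' _ (hP1 x)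
    have h3 : ‖S.T b (x - P x)‖ ≤ ‖y - P y‖ + ‖x - P x‖ := by
      rw [← hnorm, e2, norm_sub_rev (x - P x) (c • _)]
      exact norm_le_norm_sub_add _ _
    have h4 := hu' _ (hP2 x)
    have h5 : ‖y - P y‖ ≤ ‖y‖ + ‖P y‖ := norm_sub_le _ _
    have h6 : ‖x‖ ≤ ‖P x‖ + ‖x - P x‖ := by
      conv_lhs => rw [hx]
      exact norm_add_le _ _
    have h7 := P.le_opNorm y
    -- The stable part gives $\|Px\|\le2\|Py\|$, the unstable part
    -- $\|x-Px\|\le\|y-Py\|\le\|y\|+\|Py\|$.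
    have h8 : ‖x‖ ≤ ‖y‖ + 3 * ‖P y‖ := by linarith
    linarith
  · have hφ' : ∀ x, inner ℂ φ x = inner ℂ φ (c • S.T b x) := by
      intro x
      rw [← sub_eq_zero, ← inner_sub_right]
      exact hφ x
    have z1 : ∀ x ∈ Es, inner ℂ φ x = 0 := fun x hx => by
      refine inner_eq_zero_of_contraction (F := (Es : Set H)) (fun x hx => ?_) hx
      exact ⟨_, hNs x hx, hφ' x, by rw [hnorm]; exact hs' x hx⟩
    -- On the unstable space the contraction runs backwards: $x$ is replaced by $v$ with $cT(b)v=x$.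
    have z2 : ∀ x ∈ Eu, inner ℂ φ x = 0 := fun x hx => by
      refine inner_eq_zero_of_contraction (F := (Eu : Set H)) (fun x hx => ?_) hx
      obtain ⟨v, hv, hvx⟩ := (hbu b hb0).surjOn (Eu.smul_mem c⁻¹ hx)
      have hxv : x = c • S.T b v := by
        rw [hvx, smul_inv_smul₀ hc0]
      refine ⟨v, hv, ?_, ?_⟩
      · rw [hφ' v, hxv]
      · rw [hxv, hnorm]
        exact hu' v hv
    have h1 := z1 _ (hP1 φ)
    have h2 := z2 _ (hP2 φ)
    rw [← inner_self_eq_zero (𝕜 := ℂ)]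
    calc inner ℂ φ φ = inner ℂ φ (P φ) + inner ℂ φ (φ - P φ) := by
          rw [← inner_add_right, add_sub_cancel]
      _ = 0 := by rw [h1, h2, add_zero]

/-- The resolvent of the generator of a hyperbolic semigroup is bounded on the imaginary axis. -/
theorem IsGeneratorOf.exists_resolvent {A : H →ₗ.[ℂ] H} {S : C0Semigroup H}
    (hA : IsGeneratorOf A S) (hS : S.IsHyperbolic) :
    ∃ M : ℝ, ∀ ω : ℝ, ∃ R, IsResolventAt A (Complex.I * ω) R ∧ ‖R‖ ≤ M := by
  obtain ⟨b, C, hb, hC, hW⟩ := hS.exists_inverse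
  obtain ⟨K, hK1, hK⟩ := S.exists_norm_le b
  refine ⟨K * b * C, fun ω => ?_⟩
  obtain ⟨W, hW1, hW2, hW3⟩ := hW (Complex.exp (-(Complex.I * ω) * b)) (by
    rw [Complex.norm_exp]; simp)
  obtain ⟨V, hV, hVe⟩ := S.exists_truncatedLaplace hb hK (z := Complex.I * ω) (by simp)
  have h1 : ∀ x, ∃ hx : V x ∈ A.domain, (Complex.I * ω) • V x - A ⟨V x, hx⟩ =
      x - Complex.exp (-(Complex.I * ω) * b) • S.T b x := by
    intro x
    rw [hVe x]
    exact hA.integral_rescaledOrbit _ x hb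
  have h2 : ∀ y, W y - Complex.exp (-(Complex.I * ω) * b) • S.T b (W y) = y :=
    fun y => DFunLike.congr_fun hW2 y
  have h3 : ∀ y, ∃ hy : (V * W) y ∈ A.domain, (Complex.I * ω) • (V * W) y - A ⟨(V * W) y, hy⟩ = y :=
    fun y => by
      obtain ⟨hy, e⟩ := h1 (W y)
      exact ⟨hy, e.trans (h2 y)⟩
  -- The resolvent is $VW$: $(i\omega-A)V=1-e^{-i\omega b}T(b)$, which $W$ inverts. For the left
  -- inverse, $v-u$ lies in the kernel of $i\omega-A$, hence in that of $1-e^{-i\omega b}T(b)$,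
  -- which is trivial.
  refine ⟨V * W, ⟨h3, fun u => ?_⟩, (norm_mul_le _ _).trans (by gcongr)⟩
  obtain ⟨hv, e⟩ := h3 ((Complex.I * ω) • (u : H) - A u)
  set v : A.domain := ⟨_, hv⟩ with hvdef
  have h4 := hA.truncatedLaplace_apply hb hVe (v - u)
  have h5 : (Complex.I * ω) • ((v - u : A.domain) : H) - A (v - u) = 0 := by
    rw [LinearPMap.map_sub, Submodule.coe_sub, smul_sub, sub_sub_sub_comm, sub_eq_zero]
    exact e
  rw [h5, map_zero] at h4
  have h6 : ((v - u : A.domain) : H) = 0 := by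
    have h7 : W ((1 - Complex.exp (-(Complex.I * ω) * b) • S.T b) ((v - u : A.domain) : H)) =
      ((v - u : A.domain) : H) := DFunLike.congr_fun hW1 _
    rw [← h7]
    have h8 : (1 - Complex.exp (-(Complex.I * ω) * b) • S.T b) ((v - u : A.domain) : H) = 0 :=
      h4.symm
    rw [h8, map_zero]
  exact sub_eq_zero.1 h6

end HyperbolicResolvent

/-! ### Weak derivatives: du Bois-Reymond and uniqueness for $d'=zd$. -/

section WeakDerivatives

variable {X : Type*} [NormedAddCommGroup X] [NormedSpace ℂ X]

theorem contDiff_primitive {f : ℝ → ℝ} (hf : ContDiff ℝ (⊤ : ℕ∞) f) (a : ℝ) :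
    ContDiff ℝ (⊤ : ℕ∞) (fun t => ∫ s in a..t, f s) ∧
      deriv (fun t => ∫ s in a..t, f s) = f := by
  have hd : ∀ t, HasDerivAt (fun t => ∫ s in a..t, f s) (f t) t := fun t =>
    intervalIntegral.integral_hasDerivAt_right (hf.continuous.intervalIntegrable _ _)
      (hf.continuous.stronglyMeasurableAtFilter _ _) hf.continuous.continuousAt
  have he : deriv (fun t => ∫ s in a..t, f s) = f := funext fun t => (hd t).deriv
  refine ⟨?_, he⟩
  rw [contDiff_infty_iff_deriv]
  exact ⟨fun t => (hd t).differentiableAt, by rwa [he]⟩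

theorem subset_Icc_of_isCompact_of_subset_Ioo {K : Set ℝ} (hK : IsCompact K) {c d : ℝ}
    (hcd : c < d) (h : K ⊆ Ioo c d) : ∃ a b, c < a ∧ b < d ∧ K ⊆ Icc a b := by
  rcases K.eq_empty_or_nonempty with rfl | hne
  · exact ⟨d, c, hcd, hcd, empty_subset _⟩
  · exact ⟨sInf K, sSup K, (h (hK.sInf_mem hne)).1, (h (hK.sSup_mem hne)).2, fun x hx =>
      ⟨csInf_le hK.bddBelow hx, le_csSup hK.bddAbove hx⟩⟩

/-- A smooth function with compact support in an open interval and with vanishing integral has a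
primitive with compact support in this interval. -/
theorem exists_primitive_tsupport {f : ℝ → ℝ} (hf : ContDiff ℝ (⊤ : ℕ∞) f)
    (hc : HasCompactSupport f) {c d : ℝ} (hcd : c < d) (hs : tsupport f ⊆ Ioo c d)
    (h0 : ∫ s in c..d, f s = 0) : ∃ φ : ℝ → ℝ, ContDiff ℝ (⊤ : ℕ∞) φ ∧ HasCompactSupport φ ∧
      tsupport φ ⊆ Ioo c d ∧ deriv φ = f := by
  obtain ⟨a, b, ha, hb, hab⟩ := subset_Icc_of_isCompact_of_subset_Ioo hc hcd hs
  obtain ⟨h1, h2⟩ := contDiff_primitive hf c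
  have hzero : ∀ s, s ∉ Icc a b → f s = 0 := fun s hs' =>
    image_eq_zero_of_notMem_tsupport fun h => hs' (hab h)
  have hsupp : Function.support (fun t => ∫ s in c..t, f s) ⊆ Icc a b := by
    intro t ht
    by_contra hn
    apply ht
    rw [mem_Icc, not_and_or, not_le, not_le] at hn
    rcases hn with hn | hn
    · change ∫ s in c..t, f s = 0
      rw [intervalIntegral.integral_congr (g := fun _ => (0 : ℝ))]
      · simp
      · intro s hs'
        refine hzero s fun h => ?_
        have h3 : s ≤ max c t := hs'.2
        exact absurd (h3.trans_lt (max_lt ha hn)) (not_lt.2 h.1)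
    · change ∫ s in c..t, f s = 0
      rw [← intervalIntegral.integral_add_adjacent_intervals
        (hf.continuous.intervalIntegrable c d) (hf.continuous.intervalIntegrable d t), h0, zero_add,
        intervalIntegral.integral_congr (g := fun _ => (0 : ℝ))]
      · simp
      · intro s hs'
        refine hzero s fun h => ?_
        have h3 : min d t ≤ s := hs'.1
        exact absurd ((lt_min hb hn).trans_le h3) (not_lt.2 h.2)
  have ht : tsupport (fun t => ∫ s in c..t, f s) ⊆ Icc a b :=
    closure_minimal hsupp isClosed_Icc
  exact ⟨_, h1, isCompact_Icc.of_isClosed_subset (isClosed_tsupport _) ht,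
    ht.trans (Icc_subset_Ioo ha hb), h2⟩

theorem ae_μI_mem_Ioo : ∀ᵐ s ∂μI, s ∈ Ioo (-1 : ℝ) 0 := by
  rw [μI, ← restrict_Ioo_eq_restrict_Icc]
  exact ae_restrict_mem measurableSet_Ioo

theorem integral_μI {F : Type*} [NormedAddCommGroup F] [NormedSpace ℝ F] (f : ℝ → F) :
    ∫ s, f s ∂μI = ∫ s in (-1 : ℝ)..0, f s := by
  rw [intervalIntegral.integral_of_le (by norm_num), ← integral_Icc_eq_integral_Ioc]

theorem integrable_μI_of_continuous {F : Type*} [NormedAddCommGroup F] {f : ℝ → F}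
    (hf : Continuous f) : Integrable f μI :=
  hf.continuousOn.integrableOn_compact isCompact_Icc

theorem integrable_continuous_smul {a : ℝ → ℂ} (ha : Continuous a) {h : ℝ → X}
    (hh : Integrable h μI) : Integrable (fun s => a s • h s) μI := by
  obtain ⟨C, hC⟩ := (isCompact_Icc (a := (-1 : ℝ)) (b := 0)).exists_bound_of_continuousOn
    ha.continuousOn
  refine Integrable.bdd_smul (𝕜 := ℂ) hh C ha.aestronglyMeasurable ?_
  filter_upwards [ae_restrict_mem measurableSet_Icc] with s hs using hC s hs

theorem integrable_continuous_real_smul {a : ℝ → ℝ} (ha : Continuous a) {h : ℝ → X}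
    (hh : Integrable h μI) : Integrable (fun s => a s • h s) μI := by
  have := integrable_continuous_smul (Complex.continuous_ofReal.comp ha) hh
  simpa using this

/-- The du Bois-Reymond lemma: a function with vanishing weak derivative is constant. -/
theorem ae_eq_const_of_integral_deriv_smul_eq_zero [CompleteSpace X] {f : ℝ → X}
    (hf : Integrable f μI) (h : ∀ φ : ℝ → ℝ, ContDiff ℝ (⊤ : ℕ∞) φ → HasCompactSupport φ →
      tsupport φ ⊆ Ioo (-1 : ℝ) 0 → ∫ s, deriv φ s • f s ∂μI = 0) :
    ∃ c : X, f =ᵐ[μI] fun _ => c := by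
  obtain ⟨η, hη1, hη2, hη3, hη4⟩ : ∃ η : ℝ → ℝ, ContDiff ℝ (⊤ : ℕ∞) η ∧ HasCompactSupport η ∧
      tsupport η ⊆ Ioo (-1 : ℝ) 0 ∧ ∫ s in (-1 : ℝ)..0, η s = 1 := by
    let b : ContDiffBump (-1 / 2 : ℝ) := ⟨1 / 8, 1 / 4, by norm_num, by norm_num⟩
    have hsub : tsupport (b.normed volume) ⊆ Ioo (-1 : ℝ) 0 := by
      rw [b.tsupport_normed_eq]
      intro x hx
      rw [Metric.mem_closedBall, Real.dist_eq] at hx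
      have := abs_le.1 hx
      constructor <;> linarith
    refine ⟨b.normed volume, b.contDiff_normed, b.hasCompactSupport_normed, hsub, ?_⟩
    refine Eq.trans ?_ (b.integral_normed (μ := volume))
    rw [intervalIntegral.integral_of_le (by norm_num)]
    apply setIntegral_eq_integral_of_forall_compl_eq_zero
    intro x hx
    exact image_eq_zero_of_notMem_tsupport fun h => hx (Ioo_subset_Ioc_self (hsub h))
  refine ⟨∫ s, η s • f s ∂μI, ?_⟩
  set c := ∫ s, η s • f s ∂μI with hc
  have hfc : Integrable (fun s => f s - c) μI := hf.sub (integrable_const c)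
  have key := isOpen_Ioo.ae_eq_zero_of_integral_contDiff_smul_eq_zero (U := Ioo (-1 : ℝ) 0)
    (f := fun s => f s - c) (μ := μI) (hfc.locallyIntegrable.locallyIntegrableOn _) (by
      intro ψ h1 h2 h3
      set m := ∫ s in (-1 : ℝ)..0, ψ s with hm
      have c1 := h1.continuous
      have c2 := hη1.continuous
      -- Subtracting $m\eta$ makes the integral of $\psi$ zero, so the difference is the derivative
      -- of an admissible test function.
      obtain ⟨φ, p1, p2, p3, p4⟩ := exists_primitive_tsupport (f := fun s => ψ s - m * η s)
        (h1.sub (contDiff_const.mul hη1)) (h2.sub (hη2.mul_left)) (c := -1) (d := 0) (by norm_num)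
        (by
          refine (closure_mono (?_ : _ ⊆ Function.support ψ ∪ Function.support η)).trans ?_
          · intro s hs
            by_contra hn
            rw [mem_union, not_or, Function.notMem_support, Function.notMem_support] at hn
            apply hs
            simp [hn.1, hn.2]
          · rw [closure_union]
            exact union_subset h3 hη3)
        (by
          rw [intervalIntegral.integral_sub (c1.intervalIntegrable _ _)
            ((c2.intervalIntegrable _ _).const_mul m),
            intervalIntegral.integral_const_mul, hη4, mul_one, ← hm, sub_self])
      have h4 := h φ p1 p2 p3
      rw [p4] at h4
      have i1 := integrable_continuous_real_smul c1 hf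
      have i2 := integrable_continuous_real_smul c2 hf
      have e1 : ∫ s, (ψ s - m * η s) • f s ∂μI = (∫ s, ψ s • f s ∂μI) - m • c := by
        simp_rw [sub_smul, mul_smul]
        rw [integral_sub i1 (i2.fun_smul m), integral_smul]
      have e2 : ∫ s, ψ s • (f s - c) ∂μI = (∫ s, ψ s • f s ∂μI) - m • c := by
        simp_rw [smul_sub]
        rw [integral_sub i1 (integrable_continuous_real_smul c1 (integrable_const c)),
          integral_smul_const, integral_μI ψ, ← hm]
      rw [e2, ← e1]
      exact h4)
  filter_upwards [key, ae_μI_mem_Ioo] with s hs1 hs2 using sub_eq_zero.1 (hs1 hs2)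

omit [NormedSpace ℂ X] in
theorem L2.integrable (f : L2 X) : Integrable f μI := (Lp.memLp f).integrable (by norm_num)

/-- A weak solution of `d' = z d` that vanishes at `0` is zero. -/
theorem IsWeakDeriv.eq_zero_of_hasValueAtZero [CompleteSpace X] {z : ℂ} {d : L2 X}
    (h : IsWeakDeriv d (z • d)) {u : ℝ → X} (hu : ContinuousOn u (Icc (-1 : ℝ) 0))
    (hdu : d =ᵐ[μI] u) (hu0 : u 0 = 0) : d = 0 := by
  have hE : Continuous fun s : ℝ => Complex.exp (-z * s) := by fun_prop
  have hderiv : ∀ s : ℝ, HasDerivAt (fun s : ℝ => Complex.exp (-z * s))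
      (-z * Complex.exp (-z * s)) s := by
    intro s
    have := ((hasDerivAt_id (s : ℂ)).const_mul (-z)).cexp.comp_ofReal
    simpa [mul_comm] using this
  have hre : ∀ s : ℝ, HasDerivAt (fun s : ℝ => (Complex.exp (-z * s)).re)
      ((-z * Complex.exp (-z * s)).re) s := fun s =>
    Complex.reCLM.hasFDerivAt.comp_hasDerivAt s (hderiv s)
  have him : ∀ s : ℝ, HasDerivAt (fun s : ℝ => (Complex.exp (-z * s)).im)
      ((-z * Complex.exp (-z * s)).im) s := fun s =>
    Complex.imCLM.hasFDerivAt.comp_hasDerivAt s (hderiv s)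
  have hsm : ContDiff ℝ (⊤ : ℕ∞) fun s : ℝ => Complex.exp (-z * s) :=
    (contDiff_const.mul Complex.ofRealCLM.contDiff).cexp
  have hsre : ContDiff ℝ (⊤ : ℕ∞) fun s : ℝ => (Complex.exp (-z * s)).re :=
    Complex.reCLM.contDiff.comp hsm
  have hsim : ContDiff ℝ (⊤ : ℕ∞) fun s : ℝ => (Complex.exp (-z * s)).im :=
    Complex.imCLM.contDiff.comp hsm
  have hcoe : (⇑(z • d) : ℝ → X) =ᵐ[μI] fun s => z • d s := Lp.coeFn_smul z d
  -- The integrating factor gives $(e^{-zs}d)'=0$ weakly. Test functions are real, so the real and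
  -- imaginary parts of $\chi e^{-zs}$ are tested separately and recombined.
  obtain ⟨c, hc⟩ := ae_eq_const_of_integral_deriv_smul_eq_zero
    (f := fun s => Complex.exp (-z * s) • d s) (integrable_continuous_smul hE (L2.integrable d)) (by
      intro χ h1 h2 h3
      have hχd : ∀ s, HasDerivAt χ (deriv χ s) s := fun s =>
        ((h1.differentiable (by simp)) s).hasDerivAt
      have t1 := h (fun s => χ s * (Complex.exp (-z * s)).re) (h1.mul hsre) h2.mul_right
        ((tsupport_mul_subset_left).trans h3)
      have t2 := h (fun s => χ s * (Complex.exp (-z * s)).im) (h1.mul hsim) h2.mul_right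
        ((tsupport_mul_subset_left).trans h3)
      have cχ := h1.continuous
      have cχ' : Continuous (deriv χ) := h1.continuous_deriv (by simp)
      have d1 : ∀ s, deriv (fun s => χ s * (Complex.exp (-z * s)).re) s =
          deriv χ s * (Complex.exp (-z * s)).re + χ s * (-z * Complex.exp (-z * s)).re := fun s =>
        ((hχd s).mul (hre s)).deriv
      have d2 : ∀ s, deriv (fun s => χ s * (Complex.exp (-z * s)).im) s =
          deriv χ s * (Complex.exp (-z * s)).im + χ s * (-z * Complex.exp (-z * s)).im := fun s =>
        ((hχd s).mul (him s)).deriv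
      simp_rw [d1] at t1
      simp_rw [d2] at t2
      have hd := L2.integrable d
      have hzd := L2.integrable (z • d)
      have t3 : ∫ s, (((deriv χ s * (Complex.exp (-z * s)).re +
            χ s * (-z * Complex.exp (-z * s)).re) • d s +
          (χ s * (Complex.exp (-z * s)).re) • (z • d) s) +
          Complex.I • ((deriv χ s * (Complex.exp (-z * s)).im +
            χ s * (-z * Complex.exp (-z * s)).im) • d s +
          (χ s * (Complex.exp (-z * s)).im) • (z • d) s)) ∂μI = 0 := by
        have j1 := integrable_continuous_real_smul (a := fun s => deriv χ s *
          (Complex.exp (-z * s)).re + χ s * (-z * Complex.exp (-z * s)).re) (by fun_prop) hd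
        have j2 := integrable_continuous_real_smul (a := fun s => deriv χ s *
          (Complex.exp (-z * s)).im + χ s * (-z * Complex.exp (-z * s)).im) (by fun_prop) hd
        have j3 := integrable_continuous_real_smul (a := fun s => χ s *
          (Complex.exp (-z * s)).re) (by fun_prop) hzd
        have j4 := integrable_continuous_real_smul (a := fun s => χ s *
          (Complex.exp (-z * s)).im) (by fun_prop) hzd
        rw [integral_add (j1.fun_add j3) ((j2.fun_add j4).fun_smul Complex.I), integral_smul,
          integral_add j1 j3, integral_add j2 j4, t1, t2, neg_add_cancel, neg_add_cancel, smul_zero,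
          add_zero]
      rw [← t3]
      apply integral_congr_ae
      filter_upwards [hcoe] with s hs
      rw [hs]
      simp only [← Complex.coe_smul, smul_smul, ← add_smul]
      congr 1
      conv_lhs => rw [← Complex.re_add_im (Complex.exp (-z * s))]
      apply Complex.ext
      · simp; ring
      · simp; ring)
  have h2 : u =ᵐ[μI] fun s => Complex.exp (z * s) • c := by
    filter_upwards [hc, hdu] with s h1 h2
    rw [← h1, smul_smul, ← Complex.exp_add, h2]
    simp
  have h3 : EqOn u (fun s => Complex.exp (z * s) • c) (Icc (-1 : ℝ) 0) :=
    Measure.eqOn_Icc_of_ae_eq volume (by norm_num) h2 hu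
      (continuous_expFun z c).continuousOn
  have h4 : c = 0 := by
    have := h3 (right_mem_Icc.2 (by norm_num : (-1 : ℝ) ≤ 0))
    simpa [hu0] using this.symm
  rw [Lp.eq_zero_iff_ae_eq_zero]
  filter_upwards [hdu, h2] with s e1 e2
  rw [e1, e2, h4, smul_zero]
  rfl

end WeakDerivatives

/-! ### The Volterra operator as the resolvent of the nilpotent shift generator. -/

section ShiftResolvent

variable {X : Type*} [NormedAddCommGroup X] [NormedSpace ℂ X]

instance isProbabilityMeasure_μI : IsProbabilityMeasure μI := ⟨by simp [μI]⟩

/-- Integration over the triangle `-1 ≤ σ < s ≤ 0` in both orders. -/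
theorem integral_smul_integral_triangle [CompleteSpace X] {a : ℝ → ℂ} (ha : Continuous a) {h : ℝ → X}
    (hh : Integrable h μI) :
    ∫ σ, a σ • (∫ s in σ..0, h s) ∂μI = ∫ s, (∫ σ in (-1 : ℝ)..s, a σ) • h s ∂μI := by
  let F : ℝ → ℝ → X := fun σ s => {p : ℝ × ℝ | p.1 < p.2}.indicator (fun p => a p.1 • h p.2) (σ, s)
  have hms : MeasurableSet {p : ℝ × ℝ | p.1 < p.2} := measurableSet_lt measurable_fst measurable_snd
  have hF : Integrable (Function.uncurry F) (μI.prod μI) :=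
    ((integrable_μI_of_continuous ha).smul_prod hh).indicator hms
  have h1 : ∀ᵐ σ ∂μI, ∫ s, F σ s ∂μI = a σ • ∫ s in σ..0, h s := by
    filter_upwards [ae_μI_mem_Ioo] with σ hσ
    have e : F σ = (Ioi σ).indicator fun s => a σ • h s := rfl
    rw [e, integral_indicator measurableSet_Ioi, Measure.restrict_restrict measurableSet_Ioi,
      integral_smul, intervalIntegral.integral_of_le hσ.2.le]
    congr 3
    ext s
    simp only [mem_inter_iff, mem_Ioi, mem_Icc, mem_Ioc]
    exact ⟨fun h => ⟨h.1, h.2.2⟩, fun h => ⟨h.1, by linarith [hσ.1, h.1], h.2⟩⟩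
  have h2 : ∀ᵐ s ∂μI, ∫ σ, F σ s ∂μI = (∫ σ in (-1 : ℝ)..s, a σ) • h s := by
    filter_upwards [ae_μI_mem_Ioo] with s hs
    have e : (fun σ => F σ s) = (Iio s).indicator fun σ => a σ • h s := rfl
    rw [e, integral_indicator measurableSet_Iio, Measure.restrict_restrict measurableSet_Iio,
      integral_smul_const, intervalIntegral.integral_of_le hs.1.le,
      ← integral_Icc_eq_integral_Ioc, integral_Icc_eq_integral_Ico]
    congr 3
    ext σ
    simp only [mem_inter_iff, mem_Iio, mem_Icc, mem_Ico]
    exact ⟨fun h => ⟨h.2.1, h.1⟩, fun h => ⟨h.2, h.1, by linarith [hs.2, h.2]⟩⟩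
  rw [← integral_congr_ae h1, ← integral_congr_ae h2]
  exact integral_integral_swap hF

/-- The solution `σ ↦ ∫_σ^0 e^{z(σ-s)} g(s) ds` of `z f - f' = g`, `f(0) = 0`. -/
noncomputable def volterra (z : ℂ) (g : ℝ → X) (σ : ℝ) : X :=
  Complex.exp (z * σ) • ∫ s in σ..0, Complex.exp (-z * s) • g s

theorem integrable_exp_smul (z : ℂ) {g : ℝ → X} (hg : Integrable g μI) :
    Integrable (fun s : ℝ => Complex.exp (-z * s) • g s) μI :=
  integrable_continuous_smul (by fun_prop) hg

theorem intervalIntegrable_exp_smul (z : ℂ) {g : ℝ → X} (hg : Integrable g μI) {σ : ℝ}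
    (hσ : σ ∈ Icc (-1 : ℝ) 0) :
    IntervalIntegrable (fun s : ℝ => Complex.exp (-z * s) • g s) volume σ 0 := by
  rw [intervalIntegrable_iff_integrableOn_Ioc_of_le hσ.2]
  exact IntegrableOn.mono_set (integrable_exp_smul z hg)
    (Ioc_subset_Icc_self.trans (Icc_subset_Icc_left hσ.1))

theorem continuousOn_volterra (z : ℂ) {g : ℝ → X} (hg : Integrable g μI) :
    ContinuousOn (volterra z g) (Icc (-1 : ℝ) 0) := by
  have h := intervalIntegral.continuousOn_primitive_interval_left (a := (-1 : ℝ)) (b := 0)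
    (f := fun s : ℝ => Complex.exp (-z * s) • g s) (μ := volume) (by
      rw [uIcc_of_le (by norm_num)]
      exact integrable_exp_smul z hg)
  rw [uIcc_of_le (by norm_num)] at h
  exact ContinuousOn.smul (by fun_prop) h

theorem volterra_zero (z : ℂ) (g : ℝ → X) : volterra z g 0 = 0 := by
  simp [volterra]

theorem norm_volterra_le {z : ℂ} (hz : z.re = 0) {g : ℝ → X} (hg : Integrable g μI) {σ : ℝ}
    (hσ : σ ∈ Icc (-1 : ℝ) 0) : ‖volterra z g σ‖ ≤ ∫ s, ‖g s‖ ∂μI := by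
  have h1 : ∀ s : ℝ, ‖Complex.exp (-z * s)‖ = 1 := fun s => by
    rw [Complex.norm_exp]; simp [hz]
  have h2 : ‖Complex.exp (z * σ)‖ = 1 := by
    rw [Complex.norm_exp]; simp [hz]
  rw [volterra, norm_smul, h2, one_mul]
  refine (intervalIntegral.norm_integral_le_integral_norm hσ.2).trans ?_
  simp_rw [norm_smul, h1, one_mul]
  rw [intervalIntegral.integral_of_le hσ.2]
  exact setIntegral_mono_set hg.norm (Eventually.of_forall fun s => norm_nonneg _)
    (Ioc_subset_Icc_self.trans (Icc_subset_Icc_left hσ.1)).eventuallyLE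

omit [NormedSpace ℂ X] in
theorem integral_norm_le_norm (g : L2 X) : ∫ s, ‖g s‖ ∂μI ≤ ‖g‖ := by
  rw [Lp.norm_def, integral_norm_eq_lintegral_enorm (Lp.aestronglyMeasurable g),
    ← eLpNorm_one_eq_lintegral_enorm]
  exact ENNReal.toReal_mono (Lp.eLpNorm_ne_top g)
    (eLpNorm_le_eLpNorm_of_exponent_le (by norm_num) (Lp.aestronglyMeasurable g))

omit [NormedSpace ℂ X] in
theorem norm_le_of_ae_norm_le {f : L2 X} {C : ℝ} (hC : 0 ≤ C) (h : ∀ᵐ s ∂μI, ‖f s‖ ≤ C) :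
    ‖f‖ ≤ C := by
  have := Lp.norm_le_of_ae_bound hC h
  have hμ : measureUnivNNReal μI = 1 := by
    rw [measureUnivNNReal, measure_univ]
    rfl
  simpa [hμ] using this

theorem norm_expL2_le_of_re_eq_zero {z : ℂ} (hz : z.re = 0) (x : X) : ‖expL2 z x‖ ≤ ‖x‖ := by
  refine norm_le_of_ae_norm_le (norm_nonneg x) ?_
  filter_upwards [(memLp_expFun z x).coeFn_toLp] with s hs
  rw [expL2, hs, norm_smul, Complex.norm_exp]
  simp [hz]

/-- The Volterra solution operator on `L²([-1, 0], X)`. -/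
theorem exists_volterra_operator {z : ℂ} (hz : z.re = 0) :
    ∃ R : L2 X →L[ℂ] L2 X, ‖R‖ ≤ 1 ∧ ∀ g, R g =ᵐ[μI] volterra z g := by
  have hmem : ∀ g : L2 X, MemLp (volterra z g) 2 μI := fun g => by
    refine MemLp.of_bound ((continuousOn_volterra z (L2.integrable g)).aestronglyMeasurable
      measurableSet_Icc) (∫ s, ‖g s‖ ∂μI) ?_
    filter_upwards [ae_restrict_mem measurableSet_Icc] with s hs
    exact norm_volterra_le hz (L2.integrable g) hs
  have hcoe : ∀ g : L2 X, (hmem g).toLp _ =ᵐ[μI] volterra z g := fun g => (hmem g).coeFn_toLp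
  have hcongr : ∀ {g g' : ℝ → X}, g =ᵐ[μI] g' → ∀ σ ∈ Icc (-1 : ℝ) 0,
      volterra z g σ = volterra z g' σ := by
    intro g g' h σ hσ
    rw [volterra, volterra]
    congr 1
    apply intervalIntegral.integral_congr_ae_restrict
    rw [uIoc_of_le hσ.2]
    have h2 := ae_restrict_of_ae_restrict_of_subset
      (Ioc_subset_Icc_self.trans (Icc_subset_Icc_left hσ.1)) h
    filter_upwards [h2] with s hs
    rw [hs]
  refine ⟨LinearMap.mkContinuous
    { toFun := fun g => (hmem g).toLp _
      map_add' := fun g g' => ?_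
      map_smul' := fun c g => ?_ } 1 (fun g => ?_), LinearMap.mkContinuous_norm_le _ zero_le_one _,
    hcoe⟩
  · apply Lp.ext
    filter_upwards [hcoe (g + g'), hcoe g, hcoe g', Lp.coeFn_add ((hmem g).toLp _)
      ((hmem g').toLp _), ae_restrict_mem measurableSet_Icc] with σ h1 h2 h3 h4 hσ
    rw [h1, h4, Pi.add_apply, h2, h3, hcongr (Lp.coeFn_add g g') σ hσ, volterra, volterra, volterra,
      ← smul_add, ← intervalIntegral.integral_add
        (intervalIntegrable_exp_smul z (L2.integrable g) hσ)
        (intervalIntegrable_exp_smul z (L2.integrable g') hσ)]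
    simp only [Pi.add_apply, smul_add]
  · apply Lp.ext
    rw [RingHom.id_apply]
    filter_upwards [hcoe (c • g), hcoe g, Lp.coeFn_smul c ((hmem g).toLp _),
      ae_restrict_mem measurableSet_Icc] with σ h1 h2 h3 hσ
    rw [h1, h3, Pi.smul_apply, h2, hcongr (Lp.coeFn_smul c g) σ hσ, volterra, volterra, smul_comm c,
      ← intervalIntegral.integral_smul c]
    simp only [Pi.smul_apply, smul_comm c]
  · rw [one_mul]
    refine norm_le_of_ae_norm_le (norm_nonneg g) ?_
    filter_upwards [hcoe g, ae_restrict_mem measurableSet_Icc] with σ h1 hσ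
    change ‖((hmem g).toLp _ : L2 X) σ‖ ≤ _
    rw [h1]
    exact (norm_volterra_le hz (L2.integrable g) hσ).trans (integral_norm_le_norm g)

/-- Fubini on the triangle turns $\int\varphi'f$ into an integral of $g$ against
$e^{-zs}\int_{-1}^s\varphi'(\sigma)e^{z\sigma}d\sigma$. Integrating by parts, with $\varphi(-1)=0$,
leaves $\int\varphi g$ and, by Fubini again, $-z\int\varphi f$. -/
theorem isWeakDeriv_volterra [CompleteSpace X] {z : ℂ} {f g : L2 X} (hf : f =ᵐ[μI] volterra z g) :
    IsWeakDeriv f (z • f - g) := by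
  intro φ h1 h2 h3
  have hg := L2.integrable g
  have hh := integrable_exp_smul z hg
  have cφ := h1.continuous
  have cφ' : Continuous (deriv φ) := h1.continuous_deriv (by simp)
  have b1 : φ (-1) = 0 := image_eq_zero_of_notMem_tsupport (fun h => lt_irrefl _ (h3 h).1)
  have e0 : ∀ a : ℝ → ℂ, Continuous a → ∫ σ, (a σ) • f σ ∂μI =
      ∫ s, (∫ σ in (-1 : ℝ)..s, a σ * Complex.exp (z * σ)) • Complex.exp (-z * s) • g s ∂μI := by
    intro a ha
    rw [← integral_smul_integral_triangle (by fun_prop) hh]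
    apply integral_congr_ae
    filter_upwards [hf] with σ hσ
    rw [hσ, volterra, mul_smul]
  have e1 : ∀ s : ℝ, ∫ σ in (-1 : ℝ)..s, ((deriv φ σ : ℝ) : ℂ) * Complex.exp (z * σ) =
      φ s * Complex.exp (z * s) - ∫ σ in (-1 : ℝ)..s, (φ σ * z : ℂ) * Complex.exp (z * σ) := by
    intro s
    rw [eq_sub_iff_add_eq, ← intervalIntegral.integral_add
      (Continuous.intervalIntegrable (by fun_prop) _ _)
      (Continuous.intervalIntegrable (by fun_prop) _ _)]
    have hd : ∀ σ : ℝ, HasDerivAt (fun σ : ℝ => (φ σ : ℂ) * Complex.exp (z * σ))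
        (((deriv φ σ : ℝ) : ℂ) * Complex.exp (z * σ) + (φ σ * z : ℂ) * Complex.exp (z * σ)) σ := by
      intro σ
      have d1 : HasDerivAt φ (deriv φ σ) σ := ((h1.differentiable (by simp)) σ).hasDerivAt
      have d2 : HasDerivAt (fun s : ℝ => Complex.exp (z * s)) (Complex.exp (z * σ) * z) σ := by
        have := ((hasDerivAt_id (σ : ℂ)).const_mul z).cexp.comp_ofReal
        simpa using this
      refine (d1.ofReal_comp.mul d2).congr_deriv ?_
      ring
    rw [intervalIntegral.integral_eq_sub_of_hasDerivAt (fun σ _ => hd σ)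
      (Continuous.intervalIntegrable (by fun_prop) _ _), b1]
    simp
  have r1 : ∫ s, deriv φ s • f s ∂μI = ∫ s, ((deriv φ s : ℝ) : ℂ) • f s ∂μI := by
    simp only [Complex.coe_smul]
  have r2 : ∫ s, φ s • (z • f - g) s ∂μI =
      (∫ s, (φ s * z : ℂ) • f s ∂μI) - ∫ s, φ s • g s ∂μI := by
    rw [← integral_sub (integrable_continuous_smul (by fun_prop) (L2.integrable f))
      (integrable_continuous_real_smul cφ hg)]
    apply integral_congr_ae
    filter_upwards [Lp.coeFn_sub (z • f) g, Lp.coeFn_smul z f] with s e1 e2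
    rw [e1, Pi.sub_apply, e2, Pi.smul_apply, smul_sub, mul_smul, Complex.coe_smul]
  rw [r1, r2, e0 _ (by fun_prop), e0 _ (by fun_prop), neg_sub]
  simp_rw [e1, sub_smul]
  have e3 : ∀ s : ℝ, ((φ s : ℂ) * Complex.exp (z * s)) • Complex.exp (-z * s) • g s =
      φ s • g s := by
    intro s
    rw [smul_smul, mul_assoc, ← Complex.exp_add]
    simp
  simp_rw [e3]
  refine integral_sub (integrable_continuous_real_smul cφ hg) (integrable_continuous_smul ?_ hh)
  exact intervalIntegral.continuous_primitive
    (fun a b => Continuous.intervalIntegrable (by fun_prop) _ _) _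

theorem IsWeakDeriv.sub {f g f' g' : L2 X} (h : IsWeakDeriv f g) (h' : IsWeakDeriv f' g') :
    IsWeakDeriv (f - f') (g - g') := by
  have := h.add (h'.smul (-1))
  simpa [sub_eq_add_neg] using this

variable [CompleteSpace X]

theorem W12.lift_mk (w : W12 X) (h : W12.toL2 w ∈ LinearMap.range (W12.toL2 : W12 X →ₗ[ℂ] L2 X)) :
    W12.lift ⟨W12.toL2 w, h⟩ = w :=
  (LinearEquiv.ofInjective W12.toL2 W12.toL2_injective).symm_apply_apply w

/-- Injectivity of `W12.toL2` allows any representative $w$ in place of the one produced by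
`W12.lift`; `delayOperator_apply` rests on the same fact. -/
theorem shiftGen_apply {w : W12 X} {f : L2 X} (hf : f ∈ (shiftGen X).domain)
    (hw : W12.toL2 w = f) : shiftGen X ⟨f, hf⟩ = W12.deriv w := by
  subst hw
  exact congrArg W12.deriv (W12.lift_mk w ⟨w, rfl⟩)

/-- The resolvent of the nilpotent shift generator on the imaginary axis is a contraction. -/
theorem exists_isResolventAt_shiftGen {z : ℂ} (hz : z.re = 0) :
    ∃ R : L2 X →L[ℂ] L2 X, IsResolventAt (shiftGen X) z R ∧ ‖R‖ ≤ 1 := by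
  obtain ⟨R, hR1, hR⟩ := exists_volterra_operator (X := X) hz
  have hweak : ∀ g, IsWeakDeriv (R g) (z • R g - g) := fun g => isWeakDeriv_volterra (hR g)
  refine ⟨R, ⟨fun g => ?_, fun x => ?_⟩, hR1⟩
  · let w : W12 X := ⟨WithLp.toLp 2 (R g, z • R g - g), hweak g⟩
    have hw : W12.toL2 w = R g := rfl
    have hdom : R g ∈ (shiftGen X).domain :=
      ⟨w, hw, volterra z g, continuousOn_volterra z (L2.integrable g), hR g, volterra_zero z g⟩
    refine ⟨hdom, ?_⟩
    rw [shiftGen_apply hdom hw]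
    exact sub_sub_cancel _ _
  · obtain ⟨w, hw, u, hu, hwu, hu0⟩ := x.2
    rw [show x = ⟨x, x.2⟩ from rfl, shiftGen_apply x.2 hw]
    dsimp only
    rw [← hw]
    set g := z • W12.toL2 w - W12.deriv w with hg
    have hww : IsWeakDeriv (W12.toL2 w) (W12.deriv w) := w.2
    -- The difference of two solutions of $zf-f'=g$, $f(0)=0$ solves $d'=zd$, $d(0)=0$.
    have hd : IsWeakDeriv (R g - W12.toL2 w) (z • (R g - W12.toL2 w)) := by
      have := (hweak g).sub hww
      convert this using 1
      rw [hg, smul_sub]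
      abel
    refine sub_eq_zero.1 (hd.eq_zero_of_hasValueAtZero
      ((continuousOn_volterra z (L2.integrable g)).sub hu) ?_ ?_)
    · filter_upwards [Lp.coeFn_sub (R g) (W12.toL2 w), hR g, hwu] with s h1 h2 h3
      rw [h1, Pi.sub_apply, Pi.sub_apply, h2, h3]
    · rw [Pi.sub_apply, volterra_zero, hu0, sub_zero]

end ShiftResolvent

/-! ### The resolvent of the delay operator matrix. -/

section DelayResolvent

theorem exists_inverse_one_sub {E : Type*} [NormedAddCommGroup E] [NormedSpace ℂ E]
    [CompleteSpace E] {N : E →L[ℂ] E} {q : ℝ} (hq : q < 1) (hN : ‖N‖ ≤ q) :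
    ∃ J : E →L[ℂ] E, (∀ y, J y - N (J y) = y) ∧ (∀ y, J (y - N y) = y) ∧ ‖J‖ ≤ (1 - q)⁻¹ := by
  let u := Units.oneSub N (hN.trans_lt hq)
  have h1 : ∀ y, (↑u⁻¹ : E →L[ℂ] E) y - N ((↑u⁻¹ : E →L[ℂ] E) y) = y := fun y =>
    DFunLike.congr_fun u.mul_inv y
  have h2 : ∀ y, (↑u⁻¹ : E →L[ℂ] E) (y - N y) = y := fun y => DFunLike.congr_fun u.inv_mul y
  have hq' : 0 < 1 - q := sub_pos.2 hq
  refine ⟨(↑u⁻¹ : E →L[ℂ] E), h1, h2,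
    ContinuousLinearMap.opNorm_le_bound _ (inv_nonneg.2 hq'.le) fun y => ?_⟩
  set z := (↑u⁻¹ : E →L[ℂ] E) y with hz
  have h3 : ‖z‖ ≤ ‖y‖ + ‖N z‖ := by
    conv_rhs => rw [← h1 y]
    exact norm_le_norm_sub_add _ _
  have h4 := N.le_of_opNorm_le hN z
  rw [inv_mul_eq_div, le_div_iff₀ hq']
  linarith

variable {X : Type*} [NormedAddCommGroup X] [NormedSpace ℂ X] [CompleteSpace X]

theorem hasValueAtZero_expW12 (z : ℂ) (x : X) : W12.HasValueAtZero (expW12 z x) x :=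
  ⟨fun s => Complex.exp (z * s) • x, (continuous_expFun z x).continuousOn,
    (memLp_expFun z x).coeFn_toLp, by simp⟩

theorem W12.toL2_expW12 (z : ℂ) (x : X) : W12.toL2 (expW12 z x) = expL2 z x := rfl

theorem W12.deriv_expW12 (z : ℂ) (x : X) : W12.deriv (expW12 z x) = z • expL2 z x := rfl

theorem delayOperator_apply {B : X →ₗ.[ℂ] X} {Φ : W12 X →L[ℂ] X} {v : StateSpace X}
    (hv : v ∈ (delayOperator B Φ).domain) (hx : v.fst ∈ B.domain) {w : W12 X}
    (hw : W12.toL2 w = v.snd) :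
    delayOperator B Φ ⟨v, hv⟩ = WithLp.toLp 2 (B ⟨v.fst, hx⟩ + Φ w, W12.deriv w) := by
  have h : delaySnd B ⟨v, hv⟩ = w := by
    apply W12.toL2_injective
    rw [hw]
    exact congrArg Subtype.val ((LinearEquiv.ofInjective W12.toL2
      W12.toL2_injective).apply_symm_apply ⟨v.snd, w, hw⟩)
  change WithLp.toLp 2 (B ⟨v.fst, hx⟩ + Φ (delaySnd B ⟨v, hv⟩),
    W12.deriv (delaySnd B ⟨v, hv⟩)) = _
  rw [h]

theorem norm_toLp_prod_le {E F : Type*} [NormedAddCommGroup E] [NormedAddCommGroup F] (a : E)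
    (b : F) : ‖(WithLp.toLp 2 (a, b) : WithLp 2 (E × F))‖ ≤ ‖a‖ + ‖b‖ := by
  have h : (WithLp.toLp 2 (a, b) : WithLp 2 (E × F)) =
      WithLp.toLp 2 (a, 0) + WithLp.toLp 2 (0, b) := by
    rw [← WithLp.toLp_add]
    simp
  rw [h]
  refine (norm_add_le _ _).trans ?_
  rw [WithLp.norm_toLp_fst, WithLp.norm_toLp_snd]

/-- The resolvent of the delay operator matrix at a point of the imaginary axis. -/
theorem exists_isResolventAt_delayOperator {B : X →ₗ.[ℂ] X} {Φ : W12 X →L[ℂ] X} {z : ℂ}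
    (hz : z.re = 0) {R : X →L[ℂ] X} (hR : IsResolventAt B z R) {M q C : ℝ} (hM : ‖R‖ ≤ M)
    (hq : q < 1) (hΦ : ‖(delaySymbol Φ z).comp R‖ ≤ q) {F : L2 X →L[ℂ] X} (hFC : ‖F‖ ≤ C)
    (hF : ∀ f, ∃ w : W12 X, W12.toL2 w = resolvent (shiftGen X) z f ∧ F f = Φ w) :
    ∃ Q, IsResolventAt (delayOperator B Φ) z Q ∧ ‖Q‖ ≤ 2 * (M * (1 - q)⁻¹ * (1 + C)) + 1 := by
  obtain ⟨V, hV, hV1⟩ := exists_isResolventAt_shiftGen (X := X) hz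
  rw [hV.resolvent_eq] at hF
  obtain ⟨J, hJ1, hJ2, hJ⟩ := exists_inverse_one_sub hq hΦ
  have hM0 : 0 ≤ M := (norm_nonneg _).trans hM
  have hC0 : 0 ≤ C := (norm_nonneg _).trans hFC
  have hq0 : 0 < 1 - q := sub_pos.2 hq
  let fst : StateSpace X →L[ℂ] X := WithLp.fstL 2 ℂ X (L2 X)
  let snd : StateSpace X →L[ℂ] L2 X := WithLp.sndL 2 ℂ X (L2 X)
  -- With $f=e^{z\cdot}c+R(z,A_0)g$, the first row reads $(z-B)c-\Phi_zc=x+\Phi R(z,A_0)g$. Writing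
  -- $c=Ru$ turns it into $(1-\Phi_zR)u=x+\Phi R(z,A_0)g$, solved by $J$.
  let c : StateSpace X →L[ℂ] X := (R.comp J).comp (fst + F.comp snd)
  let Q : StateSpace X →L[ℂ] StateSpace X :=
    ((WithLp.prodContinuousLinearEquiv 2 ℂ X (L2 X)).symm : X × L2 X →L[ℂ] StateSpace X).comp
      (c.prod ((expL2L z).comp c + V.comp snd))
  have hc : ∀ v, c v = R (J (v.fst + F v.snd)) := fun v => rfl
  have hQ : ∀ v, Q v = WithLp.toLp 2 (c v, expL2 z (c v) + V v.snd) := fun v => rfl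
  have hcn : ∀ v, ‖c v‖ ≤ M * (1 - q)⁻¹ * (1 + C) * ‖v‖ := by
    intro v
    have h1 : ‖v.fst‖ ≤ ‖v‖ := WithLp.norm_fst_le _ v
    have h2 : ‖v.snd‖ ≤ ‖v‖ := WithLp.norm_snd_le _ v
    have h3 : ‖v.fst + F v.snd‖ ≤ (1 + C) * ‖v‖ := by
      calc _ ≤ ‖v.fst‖ + ‖F v.snd‖ := norm_add_le _ _
        _ ≤ ‖v‖ + C * ‖v‖ := by
          gcongr
          exact (F.le_of_opNorm_le hFC _).trans (by gcongr)
        _ = _ := by ring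
    rw [hc]
    calc _ ≤ M * ((1 - q)⁻¹ * ((1 + C) * ‖v‖)) :=
          (R.le_of_opNorm_le hM _).trans (by
            gcongr
            exact (J.le_of_opNorm_le hJ _).trans (by gcongr))
      _ = _ := by ring
  refine ⟨Q, ⟨fun v => ?_, fun v => ?_⟩, ?_⟩
  · obtain ⟨w, hw, hFw⟩ := hF v.snd
    obtain ⟨hd, hVe⟩ := hV.1 v.snd
    obtain ⟨w', hw', hval⟩ := id hd
    obtain rfl : w' = w := W12.toL2_injective (hw'.trans hw.symm)
    rw [shiftGen_apply _ hw] at hVe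
    obtain ⟨hRd, hRe⟩ := hR.1 (J (v.fst + F v.snd))
    have hW : W12.toL2 (expW12 z (c v) + w') = (Q v).snd := by
      rw [map_add, hw, W12.toL2_expW12]
      rfl
    have hdom : Q v ∈ (delayOperator B Φ).domain :=
      ⟨hRd, _, hW, by
        have := (hasValueAtZero_expW12 z (c v)).add hval
        rwa [add_zero] at this⟩
    refine ⟨hdom, ?_⟩
    rw [delayOperator_apply hdom hRd hW]
    have e1 : z • c v - (B ⟨c v, hRd⟩ + Φ (expW12 z (c v) + w')) = v.fst := by
      have h1 := hJ1 (v.fst + F v.snd)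
      have h2 : (delaySymbol Φ z).comp R (J (v.fst + F v.snd)) = Φ (expW12 z (c v)) := rfl
      rw [h2] at h1
      have h3 : z • c v - B ⟨c v, hRd⟩ = J (v.fst + F v.snd) := hRe
      rw [map_add, ← hFw, ← sub_sub, ← sub_sub, h3, h1, add_sub_cancel_right]
    have e2 : z • (expL2 z (c v) + V v.snd) - W12.deriv (expW12 z (c v) + w') = v.snd := by
      rw [map_add, W12.deriv_expW12, smul_add, add_sub_add_left_eq_sub, hVe]
    apply WithLp.ofLp_injective
    exact Prod.ext e1 e2
  · obtain ⟨v, hv⟩ := v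
    obtain ⟨hx, w, hw, hval⟩ := id hv
    rw [delayOperator_apply hv hx hw]
    set y : StateSpace X := z • v - WithLp.toLp 2 (B ⟨v.fst, hx⟩ + Φ w, W12.deriv w) with hy
    have y1 : y.fst = z • v.fst - (B ⟨v.fst, hx⟩ + Φ w) := rfl
    have y2 : y.snd = z • v.snd - W12.deriv w := rfl
    -- Subtracting $e^{z\cdot}f(0)$ moves $f$ into $D(A_0)$ without changing $zf-f'$.
    have hval0 : W12.HasValueAtZero (w - expW12 z v.fst) 0 := by
      have := hval.add ((hasValueAtZero_expW12 z v.fst).smul (-1))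
      simpa [sub_eq_add_neg] using this
    have hVy : V y.snd = W12.toL2 (w - expW12 z v.fst) := by
      have hd : W12.toL2 (w - expW12 z v.fst) ∈ (shiftGen X).domain := ⟨_, rfl, hval0⟩
      have h1 := hV.2 ⟨_, hd⟩
      rw [shiftGen_apply hd rfl] at h1
      have h2 : z • W12.toL2 (w - expW12 z v.fst) - W12.deriv (w - expW12 z v.fst) = y.snd := by
        rw [y2, ← hw, map_sub, map_sub, W12.toL2_expW12, W12.deriv_expW12, smul_sub]
        abel
      rwa [h2] at h1
    obtain ⟨w', hw', hFw⟩ := hF y.snd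
    obtain rfl : w' = w - expW12 z v.fst := W12.toL2_injective (hw'.trans hVy)
    have hcy : c y = v.fst := by
      have h1 : R (z • v.fst - B ⟨v.fst, hx⟩) = v.fst := hR.2 ⟨v.fst, hx⟩
      have h2 : y.fst + F y.snd = (z • v.fst - B ⟨v.fst, hx⟩) -
          (delaySymbol Φ z).comp R (z • v.fst - B ⟨v.fst, hx⟩) := by
        have h3 : (delaySymbol Φ z).comp R (z • v.fst - B ⟨v.fst, hx⟩) =
            Φ (expW12 z v.fst) := congrArg (fun x => Φ (expW12 z x)) h1
        rw [h3, y1, hFw, map_sub]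
        abel
      rw [hc, h2, hJ2, h1]
    rw [hQ, hcy, hVy, map_sub, hw, W12.toL2_expW12, add_sub_cancel]
    rfl
  · refine ContinuousLinearMap.opNorm_le_bound _ (by positivity) fun v => ?_
    have h2 : ‖v.snd‖ ≤ ‖v‖ := WithLp.norm_snd_le _ v
    have h3 : ‖V v.snd‖ ≤ ‖v‖ := (V.le_of_opNorm_le hV1 _).trans (by rwa [one_mul])
    rw [hQ]
    calc _ ≤ ‖c v‖ + ‖expL2 z (c v) + V v.snd‖ := norm_toLp_prod_le _ _
      _ ≤ ‖c v‖ + (‖c v‖ + ‖v‖) := by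
        gcongr
        exact (norm_add_le _ _).trans (add_le_add (norm_expL2_le_of_re_eq_zero hz _) h3)
      _ ≤ (2 * (M * (1 - q)⁻¹ * (1 + C)) + 1) * ‖v‖ := by
        have := hcn v
        linarith

end DelayResolvent

/-! ### The two criteria for hyperbolicity. -/

/-- The delay semigroup is hyperbolic if `sup_ω ‖Φ_{iω} R(iω, B)‖ < 1`. -/
theorem generatesHyperbolic_delayOperator {X : Type*} [NormedAddCommGroup X]
    [InnerProductSpace ℂ X] [CompleteSpace X] {Φ : W12 X →L[ℂ] X} (hΦ : Admissible Φ)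
    {B : X →ₗ.[ℂ] X} (hB : GeneratesHyperbolic B)
    (h : (⨆ ω : ℝ, ‖(delaySymbol Φ (Complex.I * ω)).comp (resolvent B (Complex.I * ω))‖ₑ) < 1) :
    GeneratesHyperbolic (delayOperator B Φ) := by
  obtain ⟨S, hS, hhyp⟩ := hB
  obtain ⟨M, hM⟩ := hS.exists_resolvent hhyp
  obtain ⟨hgen, F, hF, hFbd⟩ := hΦ
  obtain ⟨T, hT⟩ := hgen B ⟨S, hS⟩
  -- Any negative abscissa serves: the half plane must contain the imaginary axis.
  obtain ⟨-, C, hC⟩ := hFbd (-1)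
  refine ⟨T, hT, hT.isHyperbolic (M := 2 * (M * (1 - (⨆ ω : ℝ, ‖(delaySymbol Φ (Complex.I * ω)).comp
    (resolvent B (Complex.I * ω))‖ₑ).toReal)⁻¹ * (1 + C)) + 1) fun ω => ?_⟩
  obtain ⟨R, hR, hRM⟩ := hM ω
  have hz : (Complex.I * ω).re = 0 := by simp
  refine exists_isResolventAt_delayOperator hz hR hRM ?_ ?_ (hC _ (by rw [hz]; norm_num))
    (hF (Complex.I * ω))
  · have := (ENNReal.toReal_lt_toReal h.ne_top ENNReal.one_ne_top).2 h
    rwa [ENNReal.toReal_one] at this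
  -- Hyperbolicity of $B$ puts $i\omega$ in its resolvent set, so the default value $0$ of
  -- `resolvent` never enters.
  · rw [← hR.resolvent_eq, ← toReal_enorm]
    exact ENNReal.toReal_mono h.ne_top (le_iSup (fun ω : ℝ =>
      ‖(delaySymbol Φ (Complex.I * ω)).comp (resolvent B (Complex.I * ω))‖ₑ) ω)

theorem iSup_enorm_comp_lt_one {X : Type*} [NormedAddCommGroup X] [NormedSpace ℂ X]
    {Ψ R : ℝ → X →L[ℂ] X} (h : (⨆ ω, ‖Ψ ω‖ₑ) < 1 / ⨆ ω, ‖R ω‖ₑ) :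
    (⨆ ω, ‖(Ψ ω).comp (R ω)‖ₑ) < 1 := by
  have hle : (⨆ ω, ‖(Ψ ω).comp (R ω)‖ₑ) ≤ (⨆ ω, ‖Ψ ω‖ₑ) * ⨆ ω, ‖R ω‖ₑ := by
    refine iSup_le fun ω => ?_
    calc ‖(Ψ ω).comp (R ω)‖ₑ ≤ ‖Ψ ω‖ₑ * ‖R ω‖ₑ := by
          rw [← ofReal_norm, ← ofReal_norm, ← ofReal_norm, ← ENNReal.ofReal_mul (norm_nonneg _)]
          exact ENNReal.ofReal_le_ofReal ((Ψ ω).opNorm_comp_le (R ω))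
      _ ≤ _ := by
          gcongr
          · exact le_iSup (fun ω => ‖Ψ ω‖ₑ) ω
          · exact le_iSup (fun ω => ‖R ω‖ₑ) ω
  refine hle.trans_lt ?_
  -- In `ℝ≥0∞`, $1/0=\infty$ and $1/\infty=0$: the first case has product $0$, the infinite one
  -- contradicts the strict inequality.
  rcases eq_or_ne (⨆ ω, ‖R ω‖ₑ) 0 with h0 | h0
  · rw [h0, mul_zero]
    exact one_pos
  · rcases eq_or_ne (⨆ ω, ‖R ω‖ₑ) ⊤ with ht | ht
    · rw [ht, ENNReal.div_top] at h
      exact absurd h not_lt_zero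
    · exact (ENNReal.lt_div_iff_mul_lt (Or.inl h0) (Or.inl ht)).1 h

end DelayEq

theorem mainTheorem2 {X : Type*} [NormedAddCommGroup X] [InnerProductSpace ℂ X] [CompleteSpace X]
    (Φ : DelayEq.W12 X →L[ℂ] X) (hΦ : DelayEq.Admissible Φ)
    (B : X →ₗ.[ℂ] X) (hB : DelayEq.GeneratesHyperbolic B) :
    ((⨆ ω : ℝ, ‖(DelayEq.delaySymbol Φ (Complex.I * ω)).comp
          (DelayEq.resolvent B (Complex.I * ω))‖ₑ) < 1 →
      DelayEq.GeneratesHyperbolic (DelayEq.delayOperator B Φ)) ∧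
    ((⨆ ω : ℝ, ‖DelayEq.delaySymbol Φ (Complex.I * ω)‖ₑ) <
        1 / (⨆ ω : ℝ, ‖DelayEq.resolvent B (Complex.I * ω)‖ₑ) →
      DelayEq.GeneratesHyperbolic (DelayEq.delayOperator B Φ)) :=
  ⟨fun h => DelayEq.generatesHyperbolic_delayOperator hΦ hB h, fun h =>
    DelayEq.generatesHyperbolic_delayOperator hΦ hB (DelayEq.iSup_enorm_comp_lt_one h)⟩
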